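/- **Setting.** A network is an undirected connected graph on $N\ge 1$ non-Byzantine agents and $B\ge 0$ Byzantine agents, whose subgraph on the non-Byzantine agents is connected too. Non-Byzantine agent $n$ has a data distribution $\mathcal D_n$ and a dataset $S_n=\{\xi_{n,1},\dots,\xi_{n,Z}\}$, $Z\ge 1$, drawn i.i.d. from $\mathcal D_n$; all samples are independent. For a loss $f(x;\xi)$, $x\in\mathbb R^d$, put $F(x)=\frac1N\sum_n\mathbb E_{\xi\sim\mathcal D_n}f(x;\xi)$, $F_{S_n}(x)=\frac1Z\sum_z f(x;\xi_{n,z})$, $F_S=\frac1N\sum_n F_{S_n}$, and let $x_S^*$ be the minimizer of $F_S$ ($\mathbb E\|x_S^*\|^2<\infty$). *Algorithm (Byzantine-resilient DSGD).* All non-Byzantine agents start at the same $x^0$. At time $k=0,1,\dots$ each of them draws $\xi_n^k$ uniformly from $S_n$, independently of the other agents and of the past, computes $x_n^{k+1/2}=x_n^k-\alpha^k\nabla f(x_n^k;\xi_n^k)$, sends it to all its neighbours, and sets $x_n^{k+1}=\mathcal A_n(x_n^{k+1/2},\{\text{messages received from all neighbours}\})$. Byzantine agents send arbitrary messages, which may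 depend on all data, on all draws up to and including time $k$, and on further randomness, but not on later draws. Let $\bar x^k=\frac1N\sum_n x_n^k$. *Aggregation.* The aggregation rules $\mathcal A_n$ have a virtual mixing matrix $W=[w_{nm}]\in[0,1]^{N\times N}$, with rows summing to $1$ and $w_{nm}=0$ unless $m\in\mathcal N_n\cup\{n\}$ ($\mathcal N_n$: the non-Byzantine neighbours of $n$), and a contraction constant $\rho\ge0$: for all models $x_m$ of the non-Byzantine agents and all Byzantine messages, with $\hat x_n=\sum_m w_{nm}x_m$, the output of $\mathcal A_n$ is within $\rho\max_{m\in\mathcal N_n\cup\{n\}}\|x_m-\hat x_n\|$ of $\hat x_n$. Put $\lambda=1-\|(I-\frac1N\mathbf 1\mathbf 1^\top)W\|^2$ (spectral norm) and $\chi^2=\frac1N\|W^\top\mathbf 1-\mathbf 1\|^2$. *Assumptions.* For every $\xi$, $f(\cdot;\xi)$ is differentiable, $\mu$-strongly convex and has an $L$-Lipschitz gradient ($\mu,L>0$); and, almost surely in the dataset, for all $x$ and $n$, $\frac1Z\sum_z\|\nabla f(x;\xi_{n,z})-\nabla F_{S_n}(x)\|^2\le\sigma^2$ and $\frac1N\sum_m\|\nabla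 F_{S_m}(x)-\nabla F_S(x)\|^2\le\delta^2$. **Theorem.** Let $0<\lambda\le1$ and $\rho<\frac{\lambda}{8\sqrt N}$, and let the step size be $\alpha^k=\frac{2}{\mu(k+k_1)}$ with $k_1$ sufficiently large (larger than a threshold that depends only on $\mu,L,\lambda$). If $k\asymp\mu NZ$, i.e. $a\,\mu NZ\le k\le b\,\mu NZ$ with constants $0<a\le b$, then the generalization error of $\bar x^k$ is finite and $$\mathbb E\big[F(\bar x^k)-F_S(\bar x^k)\big]\le C\left(\frac{\mathbb E\|\bar x^0-x_S^*\|^2}{\mu NZ}+\frac{\sigma^2\,(1+\ln(NZ))}{\mu NZ}+\frac{\delta^2}{\mu NZ}+(4\rho^2N+\chi^2)(\sigma^2+\delta^2)\right),$$ where the constant $C$ depends only on $\mu,L,\lambda,k_1,a,b$ (in particular not on $N,Z,B,d$, the network, the data distributions, the initialization, $\sigma$, $\delta$, $\rho$, $\chi$ or the Byzantine behaviour). -/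

import Mathlib

/-!
Let `y` be the minimizer of the population loss. Strong convexity and smoothness bound
`F(x) - F_S(x)`, up to the mean-zero term `F(y) - F_S(y)`, by multiples of `‖x - x_S^*‖²` and
`‖∇F_S(y)‖²`. The gradients of the `N Z` independent samples at `y` average to `∇F_S(y)`, which has
mean zero, so their mean second moment is at least `N Z 𝔼‖∇F_S(y)‖²`. It exceeds their mean
dispersion, at most `σ² + δ²`, by `𝔼‖∇F_S(y)‖²` only; hence `(N Z - 1) 𝔼‖∇F_S(y)‖² ≤ σ² + δ²`, and
for `N Z = 1` the comparison of `y` with `x_S^*` suffices.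

It remains to bound `𝔼‖x̄ᵏ - x_S^*‖²`. For `ρ < λ / (8√N)` robust aggregation contracts the
dispersion of the local models by the factor `1 - λ / 4`, so with `αᵏ ≍ 1 / k` the dispersion is
`O(1 / k²)`. Aggregation displaces the average model by at most a multiple of `4 ρ² N + χ²` times
the dispersion, and dividing this displacement by the contraction `αᵏ μ` of a gradient step leaves
a total error of order `1 / k + 4 ρ² N + χ²`.
-/

open MeasureTheory ProbabilityTheory

/-- The space of models `ℝ^d` with its Euclidean norm. -/
abbrev Model (d : ℕ) : Type := EuclideanSpace ℝ (Fin d)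

section Loss

variable {d : ℕ} {Ξ : Type*}

/-- Every `f(· ; ξ)` is differentiable and `μ`-strongly convex. -/
def StronglyConvexLoss (f : Model d → Ξ → ℝ) (μ : ℝ) : Prop :=
  ∀ ξ : Ξ, Differentiable ℝ (fun y => f y ξ) ∧
    ∀ x y : Model d,
      f y ξ + inner ℝ (x - y) (gradient (fun u => f u ξ) y) + μ / 2 * ‖x - y‖ ^ 2 ≤ f x ξ

/-- Every `f(· ; ξ)` has an `L`-Lipschitz gradient. -/
def SmoothLoss (f : Model d → Ξ → ℝ) (L : ℝ) : Prop :=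
  ∀ (ξ : Ξ) (x y : Model d),
    ‖gradient (fun u => f u ξ) x - gradient (fun u => f u ξ) y‖ ≤ L * ‖x - y‖

/-- Population loss `F(x) = (1/N) ∑ₙ 𝔼_{ξ ∼ Dₙ} f(x; ξ)`. -/
noncomputable def populationLoss {N : ℕ} [MeasurableSpace Ξ] (f : Model d → Ξ → ℝ)
    (D : Fin N → Measure Ξ) (x : Model d) : ℝ :=
  (1 / (N : ℝ)) * ∑ n, ∫ ξ, f x ξ ∂(D n)

/-- Local empirical loss `(1/Z) ∑_z f(x; s_z)` of a dataset `s` of `Z` samples. -/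
noncomputable def localLoss {Z : ℕ} (f : Model d → Ξ → ℝ) (s : Fin Z → Ξ) (x : Model d) : ℝ :=
  (1 / (Z : ℝ)) * ∑ z, f x (s z)

/-- Global empirical loss: the average of the local empirical losses over the `N` agents. -/
noncomputable def empiricalLoss {N Z : ℕ} (f : Model d → Ξ → ℝ) (S : Fin N → Fin Z → Ξ)
    (x : Model d) : ℝ :=
  (1 / (N : ℝ)) * ∑ n, localLoss f (S n) x

/-- Bounded stochastic gradient noise: at every point, the gradient at a sample drawn uniformly
from the local dataset of any agent has variance at most `σ²`. -/
def BoundedNoise {N Z : ℕ} (f : Model d → Ξ → ℝ) (S : Fin N → Fin Z → Ξ) (σ : ℝ) : Prop :=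
  ∀ (x : Model d) (n : Fin N),
    (1 / (Z : ℝ)) * ∑ z, ‖gradient (fun u => f u (S n z)) x - gradient (localLoss f (S n)) x‖ ^ 2
      ≤ σ ^ 2

/-- Bounded heterogeneity of the local empirical losses. -/
def BoundedHeterogeneity {N Z : ℕ} (f : Model d → Ξ → ℝ) (S : Fin N → Fin Z → Ξ) (δ : ℝ) : Prop :=
  ∀ x : Model d,
    (1 / (N : ℝ)) * ∑ n, ‖gradient (localLoss f (S n)) x - gradient (empiricalLoss f S) x‖ ^ 2
      ≤ δ ^ 2

end Loss

section Aggregation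

variable {N B : ℕ}

/-- An aggregation rule of the non-Byzantine agent `n` in the network `G`, whose vertices are the
`N` non-Byzantine agents `Sum.inl n` and the `B` Byzantine agents `Sum.inr b`: it maps the agent's
own model and the messages of all its neighbours to a new model. -/
abbrev AggregationRule (G : SimpleGraph (Fin N ⊕ Fin B)) (d : ℕ) (n : Fin N) : Type :=
  Model d → (G.neighborSet (Sum.inl n) → Model d) → Model d

/-- `W` is a virtual mixing matrix and `ρ` a contraction constant of the rules `A`. Here `u m` is
the model of the non-Byzantine agent `m` and `v b` the (arbitrary) message of the Byzantine
agent `b`; the rule of agent `n` only sees those of its neighbours. -/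
structure IsVirtualMixing {d : ℕ} (G : SimpleGraph (Fin N ⊕ Fin B))
    (A : (n : Fin N) → AggregationRule G d n) (W : Matrix (Fin N) (Fin N) ℝ) (ρ : ℝ) : Prop where
  weight_mem : ∀ n m, W n m ∈ Set.Icc (0 : ℝ) 1
  weight_eq_zero : ∀ n m, m ≠ n → ¬ G.Adj (Sum.inl n) (Sum.inl m) → W n m = 0
  row_sum : ∀ n, ∑ m, W n m = 1
  rho_nonneg : 0 ≤ ρ
  contraction : ∀ (n : Fin N) (u : Fin N → Model d) (v : Fin B → Model d),
    ‖A n (u n) (fun m => Sum.elim u v m.1) - ∑ m, W n m • u m‖ ≤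
      ρ * ⨆ m : {m : Fin N // m = n ∨ G.Adj (Sum.inl n) (Sum.inl m)},
        ‖u m.1 - ∑ m', W n m' • u m'‖

/-- `λ = 1 - ‖(I - (1/N) 1 1ᵀ) W‖²` with the spectral norm. -/
noncomputable def mixingGap (W : Matrix (Fin N) (Fin N) ℝ) : ℝ :=
  1 - ‖Matrix.toEuclideanCLM (n := Fin N) (𝕜 := ℝ)
    ((1 - (1 / (N : ℝ)) • Matrix.of (fun _ _ => (1 : ℝ))) * W)‖ ^ 2

/-- `χ² = (1/N) ‖Wᵀ 1 - 1‖²`. -/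
noncomputable def chiSq (W : Matrix (Fin N) (Fin N) ℝ) : ℝ :=
  (1 / (N : ℝ)) * ∑ m, (∑ n, W n m - 1) ^ 2

end Aggregation

section Algorithm

variable {N B Z d : ℕ} {Ξ Ω : Type*}

/-- The local model after the gradient step with step size `α`, from the local models `x`, with
the sample number `i n` of agent `n`'s dataset. -/
noncomputable def halfStep (f : Model d → Ξ → ℝ) (S : Fin N → Fin Z → Ξ) (α : ℝ)
    (i : Fin N → Fin Z) (x : Fin N → Model d) (n : Fin N) : Model d :=
  x n - α • gradient (fun u => f u (S n (i n))) (x n)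

/-- Byzantine-resilient DSGD: the local models of the non-Byzantine agents at time `k`, for the
outcome `ω`. `S` is the random dataset, `α` the step sizes, `idx k ω n` the number of the sample
drawn by agent `n` at time `k`, and `byz k b n ω` the message that the Byzantine agent `b` sends to
agent `n` at time `k`. -/
noncomputable def dsgd (f : Model d → Ξ → ℝ) (G : SimpleGraph (Fin N ⊕ Fin B))
    (A : (n : Fin N) → AggregationRule G d n) (α : ℕ → ℝ) (x₀ : Model d)
    (S : Ω → Fin N → Fin Z → Ξ) (idx : ℕ → Ω → Fin N → Fin Z)
    (byz : ℕ → Fin B → Fin N → Ω → Model d) : ℕ → Ω → Fin N → Model d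
  | 0, _, _ => x₀
  | k + 1, ω, n =>
      let h := halfStep f (S ω) (α k) (idx k ω) (dsgd f G A α x₀ S idx byz k ω)
      A n (h n) (fun m => Sum.elim h (fun b => byz k b n ω) m.1)

/-- The average of the `N` local models. -/
noncomputable def meanModel (x : Fin N → Model d) : Model d :=
  (1 / (N : ℝ)) • ∑ n, x n

/-- The probabilistic setup. The samples of the dataset `S` are independent, those of agent `n`
with law `D n`, and are known at time `0`. At time `k` the agents draw sample numbers uniformly,
independently of each other and of the past `𝓕 k`. The Byzantine messages sent at time `k` are
arbitrary `𝓕 (k + 1)`-measurable: they may depend on the dataset, on all draws up to and including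
time `k` and on further randomness, but not on later draws. -/
structure IsByzantineSetup [MeasurableSpace Ξ] {mΩ : MeasurableSpace Ω} (P : Measure Ω)
    (𝓕 : Filtration ℕ mΩ) (D : Fin N → Measure Ξ) (S : Ω → Fin N → Fin Z → Ξ)
    (idx : ℕ → Ω → Fin N → Fin Z) (byz : ℕ → Fin B → Fin N → Ω → Model d) : Prop where
  data_meas : ∀ n z, Measurable[𝓕 0] (fun ω => S ω n z)
  data_indep : iIndepFun (fun (p : Fin N × Fin Z) ω => S ω p.1 p.2) P
  data_law : ∀ n z, P.map (fun ω => S ω n z) = D n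
  idx_meas : ∀ k, Measurable[𝓕 (k + 1)] (idx k)
  idx_uniform : ∀ k (j : Fin N → Fin Z), P {ω | idx k ω = j} = ((Z : ENNReal) ^ N)⁻¹
  idx_indep : ∀ k, Indep (MeasurableSpace.comap (idx k) inferInstance) (𝓕 k) P
  byz_meas : ∀ k b n, Measurable[𝓕 (k + 1)] (byz k b n)

end Algorithm

section Average

variable {ι E : Type*} [Fintype ι]

/-- The average `(1/|ι|) ∑ᵢ uᵢ` of a finite family of vectors; it is `0` for the empty family. -/
noncomputable def avg [AddCommGroup E] [Module ℝ E] (u : ι → E) : E :=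
  (1 / (Fintype.card ι : ℝ)) • ∑ i, u i

section Module

variable [AddCommGroup E] [Module ℝ E]

lemma avg_add (u v : ι → E) : avg (fun i => u i + v i) = avg u + avg v := by
  simp only [avg, Finset.sum_add_distrib, smul_add]

lemma avg_sub (u v : ι → E) : avg (fun i => u i - v i) = avg u - avg v := by
  simp only [avg, Finset.sum_sub_distrib, smul_sub]

lemma avg_smul (c : ℝ) (u : ι → E) : avg (fun i => c • u i) = c • avg u := by
  simp only [avg, ← Finset.smul_sum, smul_comm c]

lemma avg_const [Nonempty ι] (c : E) : avg (fun _ : ι => c) = c := by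
  have h : (Fintype.card ι : ℝ) ≠ 0 := by simp
  simp only [avg, Finset.sum_const, Finset.card_univ, ← Nat.cast_smul_eq_nsmul ℝ, smul_smul,
    one_div_mul_cancel h, one_smul]

lemma avg_sub_const [Nonempty ι] (u : ι → E) (c : E) : avg (fun i => u i - c) = avg u - c := by
  rw [avg_sub, avg_const]

lemma avg_avg_eq_avg_prod {κ : Type*} [Fintype κ] (u : ι → κ → E) :
    avg (fun i => avg (u i)) = avg fun p : ι × κ => u p.1 p.2 := by
  simp only [avg, ← Finset.smul_sum, smul_smul, Fintype.sum_prod_type, Fintype.card_prod,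
    Nat.cast_mul, one_div_mul_one_div]

end Module

lemma avg_const_mul (c : ℝ) (u : ι → ℝ) : avg (fun i => c * u i) = c * avg u :=
  avg_smul c u

lemma avg_mono {u v : ι → ℝ} (h : ∀ i, u i ≤ v i) : avg u ≤ avg v := by
  unfold avg
  gcongr with i
  exact h i

lemma avg_nonneg {u : ι → ℝ} (h : ∀ i, 0 ≤ u i) : 0 ≤ avg u :=
  smul_nonneg (by positivity) (Finset.sum_nonneg fun i _ => h i)

lemma avg_le_of_forall_le [Nonempty ι] {u : ι → ℝ} {c : ℝ} (h : ∀ i, u i ≤ c) : avg u ≤ c :=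
  (avg_mono h).trans_eq (avg_const c)

lemma le_card_mul_avg {u : ι → ℝ} (h : ∀ i, 0 ≤ u i) (i : ι) : u i ≤ Fintype.card ι * avg u := by
  have hι : (Fintype.card ι : ℝ) ≠ 0 := by simpa using Fintype.card_pos_iff.2 ⟨i⟩ |>.ne'
  rw [avg, smul_eq_mul, ← mul_assoc, mul_one_div_cancel hι, one_mul]
  exact Finset.single_le_sum (fun j _ => h j) (Finset.mem_univ i)

lemma norm_avg_le [SeminormedAddCommGroup E] [NormedSpace ℝ E] (u : ι → E) :
    ‖avg u‖ ≤ avg fun i => ‖u i‖ := by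
  rw [avg, norm_smul, Real.norm_of_nonneg (by positivity)]
  exact mul_le_mul_of_nonneg_left (norm_sum_le _ _) (by positivity)

lemma norm_add_sq_le_young [SeminormedAddCommGroup E] (a b : E) {η : ℝ} (hη : 0 < η) :
    ‖a + b‖ ^ 2 ≤ (1 + η) * ‖a‖ ^ 2 + (1 + 1 / η) * ‖b‖ ^ 2 := by
  have key : (1 + η) * ‖a‖ ^ 2 + (1 + 1 / η) * ‖b‖ ^ 2 - (‖a‖ + ‖b‖) ^ 2
      = (η * ‖a‖ - ‖b‖) ^ 2 / η := by
    field_simp; ring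
  have h0 : 0 ≤ (η * ‖a‖ - ‖b‖) ^ 2 / η := by positivity
  have h1 : ‖a + b‖ ^ 2 ≤ (‖a‖ + ‖b‖) ^ 2 := by gcongr; exact norm_add_le a b
  linarith

lemma norm_add_sq_le_two_mul [SeminormedAddCommGroup E] (a b : E) :
    ‖a + b‖ ^ 2 ≤ 2 * ‖a‖ ^ 2 + 2 * ‖b‖ ^ 2 := by
  simpa [one_add_one_eq_two] using norm_add_sq_le_young a b one_pos

lemma norm_add_three_sq_le [SeminormedAddCommGroup E] (a b c : E) :
    ‖a + b + c‖ ^ 2 ≤ 3 * (‖a‖ ^ 2 + ‖b‖ ^ 2 + ‖c‖ ^ 2) := by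
  have h := pow_le_pow_left₀ (norm_nonneg _) (norm_add₃_le (a := a) (b := b) (c := c)) 2
  nlinarith [sq_nonneg (‖a‖ - ‖b‖), sq_nonneg (‖b‖ - ‖c‖), sq_nonneg (‖a‖ - ‖c‖)]

end Average

section Dispersion

variable {ι E : Type*} [Fintype ι] [NormedAddCommGroup E] [InnerProductSpace ℝ E]

lemma inner_avg_left (u : ι → E) (v : E) : inner ℝ (avg u) v = avg fun i => inner ℝ (u i) v := by
  simp only [avg, inner_smul_left, sum_inner, RCLike.conj_to_real, smul_eq_mul]

/-- The mean squared distance of a finite family of vectors to its average, which measures how far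
the agents are from consensus. -/
noncomputable def dispersion (u : ι → E) : ℝ :=
  avg fun i => ‖u i - avg u‖ ^ 2

lemma dispersion_nonneg (u : ι → E) : 0 ≤ dispersion u :=
  avg_nonneg fun _ => sq_nonneg _

lemma norm_sub_avg_sq_le (u : ι → E) (i : ι) :
    ‖u i - avg u‖ ^ 2 ≤ Fintype.card ι * dispersion u :=
  le_card_mul_avg (u := fun i => ‖u i - avg u‖ ^ 2) (fun _ => sq_nonneg _) i

lemma dispersion_add_le (u v : ι → E) {η : ℝ} (hη : 0 < η) :
    dispersion (fun i => u i + v i) ≤ (1 + η) * dispersion u + (1 + 1 / η) * dispersion v := by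
  simp only [dispersion, ← avg_const_mul]
  rw [← avg_add, avg_add u v]
  refine avg_mono fun i => ?_
  rw [add_sub_add_comm]
  exact norm_add_sq_le_young _ _ hη

variable [Nonempty ι]

lemma avg_norm_sub_sq_eq (u : ι → E) (c : E) :
    avg (fun i => ‖u i - c‖ ^ 2) = dispersion u + ‖avg u - c‖ ^ 2 := by
  have hsplit : ∀ i, ‖u i - c‖ ^ 2
      = ‖u i - avg u‖ ^ 2 + 2 * inner ℝ (u i - avg u) (avg u - c) + ‖avg u - c‖ ^ 2 := fun i => by
    rw [← norm_add_sq_real, sub_add_sub_cancel]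
  have hcross : avg (fun i => inner ℝ (u i - avg u) (avg u - c)) = 0 := by
    rw [← inner_avg_left, avg_sub_const, sub_self, inner_zero_left]
  simp only [hsplit, avg_add, avg_const_mul, hcross, avg_const, mul_zero, add_zero, dispersion]

lemma dispersion_le_avg_norm_sub_sq (u : ι → E) (c : E) :
    dispersion u ≤ avg fun i => ‖u i - c‖ ^ 2 := by
  rw [avg_norm_sub_sq_eq]
  exact le_add_of_nonneg_right (sq_nonneg _)

lemma norm_avg_sub_sq_le (u : ι → E) (c : E) :
    ‖avg u - c‖ ^ 2 ≤ avg fun i => ‖u i - c‖ ^ 2 := by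
  rw [avg_norm_sub_sq_eq]
  exact le_add_of_nonneg_left (dispersion_nonneg u)

lemma norm_avg_sq_le (u : ι → E) : ‖avg u‖ ^ 2 ≤ avg fun i => ‖u i‖ ^ 2 := by
  simpa only [sub_zero] using norm_avg_sub_sq_le u (0 : E)

lemma dispersion_const (c : E) : dispersion (fun _ : ι => c) = 0 := by
  simp only [dispersion, avg_const, sub_self, norm_zero, ne_eq, OfNat.ofNat_ne_zero,
    not_false_eq_true, zero_pow]

end Dispersion

section SquareIntegrable

variable {Ω E : Type*} {mΩ : MeasurableSpace Ω} {P : Measure Ω} [NormedAddCommGroup E]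

lemma integrable_norm_sq {u : Ω → E} (hu : MemLp u 2 P) : Integrable (fun ω => ‖u ω‖ ^ 2) P :=
  (memLp_two_iff_integrable_sq_norm hu.1).1 hu

variable {ι : Type*} [Fintype ι]

lemma memLp_avg [NormedSpace ℝ E] {p : ENNReal} {u : ι → Ω → E} (hu : ∀ i, MemLp (u i) p P) :
    MemLp (fun ω => avg fun i => u i ω) p P :=
  (memLp_finsetSum Finset.univ fun i _ => hu i).const_smul (1 / (Fintype.card ι : ℝ))

lemma integrable_avg [NormedSpace ℝ E] {u : ι → Ω → E} (hu : ∀ i, Integrable (u i) P) :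
    Integrable (fun ω => avg fun i => u i ω) P :=
  (integrable_finsetSum Finset.univ fun i _ => hu i).smul (1 / (Fintype.card ι : ℝ))

lemma integral_avg [NormedSpace ℝ E] {u : ι → Ω → E} (hu : ∀ i, Integrable (u i) P) :
    ∫ ω, avg (fun i => u i ω) ∂P = avg fun i => ∫ ω, u i ω ∂P := by
  simp only [avg, integral_smul]
  rw [integral_finsetSum _ fun i _ => hu i]

lemma norm_integral_sq_le [NormedSpace ℝ E] [CompleteSpace E] [IsProbabilityMeasure P] {u : Ω → E}
    (hu : MemLp u 2 P) : ‖∫ ω, u ω ∂P‖ ^ 2 ≤ ∫ ω, ‖u ω‖ ^ 2 ∂P :=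
  (convexOn_univ_norm.pow (fun _ _ => norm_nonneg _) 2).map_integral_le (by fun_prop) isClosed_univ
    (.of_forall fun _ => Set.mem_univ _) (hu.integrable one_le_two) (integrable_norm_sq hu)

variable [InnerProductSpace ℝ E]

lemma integrable_inner {u v : Ω → E} (hu : MemLp u 2 P) (hv : MemLp v 2 P) :
    Integrable (fun ω => inner ℝ (u ω) (v ω)) P :=
  (hu.norm.integrable_mul hv.norm).mono' (hu.1.inner hv.1)
    (.of_forall fun ω => norm_inner_le_norm (u ω) (v ω))

lemma integral_norm_sub_smul_sq {u v : Ω → E} (hu : MemLp u 2 P) (hv : MemLp v 2 P)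
    (horth : ∫ ω, inner ℝ (v ω) (u ω) ∂P = 0) (c : ℝ) :
    ∫ ω, ‖u ω - c • v ω‖ ^ 2 ∂P = ∫ ω, ‖u ω‖ ^ 2 ∂P + c ^ 2 * ∫ ω, ‖v ω‖ ^ 2 ∂P := by
  have hcross_int := (integrable_inner hv hu).const_mul (2 * c)
  have hv_int := (integrable_norm_sq hv).const_mul (c ^ 2)
  have hsub_int : Integrable (fun ω => ‖u ω‖ ^ 2 - 2 * c * inner ℝ (v ω) (u ω)) P :=
    (integrable_norm_sq hu).sub hcross_int
  have hexpand : ∀ ω, ‖u ω - c • v ω‖ ^ 2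
      = ‖u ω‖ ^ 2 - 2 * c * inner ℝ (v ω) (u ω) + c ^ 2 * ‖v ω‖ ^ 2 := fun ω => by
    rw [norm_sub_sq_real, inner_smul_right, norm_smul, mul_pow, Real.norm_eq_abs, sq_abs,
      real_inner_comm, mul_assoc]
  simp only [hexpand]
  rw [integral_add hsub_int hv_int, integral_sub (integrable_norm_sq hu) hcross_int,
    integral_const_mul, integral_const_mul, horth, mul_zero, sub_zero]

lemma integrable_dispersion {u : ι → Ω → E} (hu : ∀ i, MemLp (u i) 2 P) :
    Integrable (fun ω => dispersion fun i => u i ω) P :=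
  integrable_avg fun i => integrable_norm_sq ((hu i).sub (memLp_avg hu))

end SquareIntegrable

section StronglyMonotone

variable {E : Type*} [NormedAddCommGroup E] [InnerProductSpace ℝ E]

/-- The maps with the two properties of the gradient of a `μ`-strongly convex function with
`L`-Lipschitz gradient that the analysis uses. -/
structure StronglyMonotoneLip (μ L : ℝ) (G : E → E) : Prop where
  mono : ∀ x y, μ * ‖x - y‖ ^ 2 ≤ inner ℝ (G x - G y) (x - y)
  lip : ∀ x y, ‖G x - G y‖ ≤ L * ‖x - y‖

namespace StronglyMonotoneLip

variable {μ L : ℝ} {G : E → E}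

protected lemma avg {ι : Type*} [Fintype ι] [Nonempty ι] {G : ι → E → E}
    (hG : ∀ i, StronglyMonotoneLip μ L (G i)) :
    StronglyMonotoneLip μ L fun x => avg fun i => G i x where
  mono x y := by
    rw [← avg_sub, inner_avg_left, ← avg_const (ι := ι) (μ * ‖x - y‖ ^ 2)]
    exact avg_mono fun i => (hG i).mono x y
  lip x y := by
    rw [← avg_sub]
    exact (norm_avg_le _).trans (avg_le_of_forall_le fun i => (hG i).lip x y)

protected lemma continuous (hG : StronglyMonotoneLip μ L G) : Continuous G :=
  (LipschitzWith.of_dist_le' fun x y => by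
    simpa only [dist_eq_norm] using hG.lip x y).continuous

lemma norm_step_sub_step_sq_le (hG : StronglyMonotoneLip μ L G) {α : ℝ} (hα : 0 ≤ α)
    (hαL : α * L ^ 2 ≤ μ) (x y : E) :
    ‖(x - α • G x) - (y - α • G y)‖ ^ 2 ≤ (1 - α * μ) * ‖x - y‖ ^ 2 := by
  have hlip : ‖G x - G y‖ ^ 2 ≤ L ^ 2 * ‖x - y‖ ^ 2 := by
    rw [← mul_pow]; gcongr; exact hG.lip x y
  have hquad : α ^ 2 * ‖G x - G y‖ ^ 2 ≤ α * μ * ‖x - y‖ ^ 2 :=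
    calc α ^ 2 * ‖G x - G y‖ ^ 2 ≤ α ^ 2 * (L ^ 2 * ‖x - y‖ ^ 2) := by gcongr
      _ = α * (α * L ^ 2) * ‖x - y‖ ^ 2 := by ring
      _ ≤ α * μ * ‖x - y‖ ^ 2 := by gcongr
  have hmono := mul_le_mul_of_nonneg_left (hG.mono x y) hα
  rw [sub_sub_sub_comm, ← smul_sub, norm_sub_sq_real, inner_smul_right, norm_smul, mul_pow,
    Real.norm_eq_abs, sq_abs, real_inner_comm]
  linarith

lemma mul_norm_sub_le (hG : StronglyMonotoneLip μ L G) (x y : E) :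
    μ * ‖x - y‖ ≤ ‖G x - G y‖ := by
  rcases (norm_nonneg (x - y)).eq_or_lt with h | h
  · rw [← h, mul_zero]; positivity
  · have := (hG.mono x y).trans (real_inner_le_norm _ _)
    exact le_of_mul_le_mul_right (by linarith) h

lemma mul_norm_sub_zero_le (hG : StronglyMonotoneLip μ L G) {y : E} (hy : G y = 0) (x : E) :
    μ * ‖x - y‖ ≤ ‖G x‖ := by
  simpa only [hy, sub_zero] using hG.mul_norm_sub_le x y

lemma norm_le_of_zero (hG : StronglyMonotoneLip μ L G) {y : E} (hy : G y = 0) (x : E) :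
    ‖G x‖ ≤ L * ‖x - y‖ := by
  simpa only [hy, sub_zero] using hG.lip x y

lemma zero_unique (hG : StronglyMonotoneLip μ L G) (hμ : 0 < μ) {x y : E} (hx : G x = 0)
    (hy : G y = 0) : x = y := by
  have h := hG.mul_norm_sub_zero_le hy x
  rw [hx, norm_zero] at h
  exact sub_eq_zero.1 (norm_le_zero_iff.1 (nonpos_of_mul_nonpos_right h hμ))

lemma exists_contractingWith_step (hμ : 0 < μ) (L : ℝ) :
    ∃ (γ : ℝ) (K : NNReal), 0 < γ ∧ ∀ G : E → E, StronglyMonotoneLip μ L G →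
      ContractingWith K fun x => x - γ • G x := by
  have hγ : 0 < μ / (L ^ 2 + μ ^ 2) := by positivity
  have hγL : μ / (L ^ 2 + μ ^ 2) * L ^ 2 ≤ μ := by
    rw [div_mul_eq_mul_div, div_le_iff₀ (by positivity)]; nlinarith [pow_pos hμ 3]
  set γ := μ / (L ^ 2 + μ ^ 2)
  refine ⟨γ, (√(1 - γ * μ)).toNNReal, hγ, fun G hG => ⟨?_, .of_dist_le_mul fun x y => ?_⟩⟩
  · rw [Real.toNNReal_lt_one, Real.sqrt_lt' one_pos]
    nlinarith [mul_pos hγ hμ]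
  · have hstep := hG.norm_step_sub_step_sq_le hγ.le hγL x y
    rw [dist_eq_norm, dist_eq_norm, Real.coe_toNNReal _ (Real.sqrt_nonneg _),
      ← Real.sqrt_sq (norm_nonneg (x - y)), ← Real.sqrt_mul' _ (sq_nonneg _)]
    exact Real.le_sqrt_of_sq_le hstep

section Measurable

variable [MeasurableSpace E] [BorelSpace E] [SecondCountableTopology E]
  {Ω : Type*} {mΩ : MeasurableSpace Ω} {G : Ω → E → E}

lemma measurable_comp (hG : ∀ ω, StronglyMonotoneLip μ L (G ω))
    (hm : ∀ x, Measurable fun ω => G ω x) {u : Ω → E} (hu : Measurable u) :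
    Measurable fun ω => G ω (u ω) :=
  (measurable_uncurry_of_continuous_of_measurable (u := fun x ω => G ω x)
    (fun ω => (hG ω).continuous) hm).comp (hu.prodMk measurable_id)

lemma exists_measurable_zero [CompleteSpace E] (hμ : 0 < μ)
    (hG : ∀ ω, StronglyMonotoneLip μ L (G ω)) (hm : ∀ x, Measurable fun ω => G ω x) :
    ∃ y : Ω → E, Measurable y ∧ ∀ ω, G ω (y ω) = 0 := by
  obtain ⟨γ, K, hγ, hK⟩ := exists_contractingWith_step (E := E) hμ L
  let T : Ω → E → E := fun ω x => x - γ • G ω x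
  have hT : ∀ ω, ContractingWith K (T ω) := fun ω => hK (G ω) (hG ω)
  have hiter : ∀ t : ℕ, Measurable fun ω => (T ω)^[t] 0 := fun t => by
    induction t with
    | zero => exact measurable_const
    | succ t ih =>
      simp only [Function.iterate_succ_apply']
      exact ih.sub ((measurable_comp hG hm ih).const_smul γ)
  refine ⟨fun ω => (hT ω).fixedPoint, measurable_of_tendsto_metrizable hiter
    (tendsto_pi_nhds.2 fun ω => (hT ω).tendsto_iterate_fixedPoint 0), fun ω => ?_⟩
  have hfix : T ω _ = _ := (hT ω).fixedPoint_isFixedPt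
  simpa only [T, sub_eq_self, smul_eq_zero, hγ.ne', false_or] using hfix

lemma memLp_comp {P : Measure Ω} (hG : ∀ ω, StronglyMonotoneLip μ L (G ω))
    (hm : ∀ x, Measurable fun ω => G ω x) {xs : Ω → E} (hxs : MemLp xs 2 P)
    (hzero : ∀ ω, G ω (xs ω) = 0) {u : Ω → E} (hum : Measurable u) (hu : MemLp u 2 P) :
    MemLp (fun ω => G ω (u ω)) 2 P :=
  (hu.sub hxs).of_le_mul (measurable_comp hG hm hum).aestronglyMeasurable
    (.of_forall fun ω => (hG ω).norm_le_of_zero (hzero ω) (u ω))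

end Measurable

section Integral

variable [CompleteSpace E] {Ω : Type*} {mΩ : MeasurableSpace Ω} {P : Measure Ω}
  [IsProbabilityMeasure P] {G : Ω → E → E}

protected lemma integral (hG : ∀ ω, StronglyMonotoneLip μ L (G ω))
    (hint : ∀ x, Integrable (fun ω => G ω x) P) :
    StronglyMonotoneLip μ L fun x => ∫ ω, G ω x ∂P where
  mono x y := by
    have hsub : Integrable (fun ω => G ω x - G ω y) P := (hint x).sub (hint y)
    rw [← integral_sub (hint x) (hint y), real_inner_comm, ← integral_inner hsub]
    simp only [real_inner_comm _ (x - y)]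
    calc μ * ‖x - y‖ ^ 2 = ∫ _, μ * ‖x - y‖ ^ 2 ∂P := by simp
      _ ≤ _ := integral_mono (integrable_const _)
        (hsub.inner_const (x - y)) fun ω => (hG ω).mono x y
  lip x y := by
    rw [← integral_sub (hint x) (hint y)]
    simpa using norm_integral_le_of_norm_le_const (μ := P) (.of_forall fun ω => (hG ω).lip x y)

variable [MeasurableSpace E] [BorelSpace E] [SecondCountableTopology E] {xs : Ω → E}

lemma integral_norm_sq_le (hμ : 0 < μ) (hG : ∀ ω, StronglyMonotoneLip μ L (G ω))
    (hm : ∀ x, Measurable fun ω => G ω x) (hxs : MemLp xs 2 P) (hzero : ∀ ω, G ω (xs ω) = 0)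
    {y : E} (hy : ∫ ω, G ω y ∂P = 0) (x₀ : E) :
    ∫ ω, ‖G ω y‖ ^ 2 ∂P ≤ 2 * L ^ 2 * (L ^ 2 / μ ^ 2 + 1) * ∫ ω, ‖x₀ - xs ω‖ ^ 2 ∂P := by
  have hG2 : ∀ x, MemLp (fun ω => G ω x) 2 P := fun x =>
    memLp_comp hG hm hxs hzero measurable_const (memLp_const x)
  have hd : ∀ x, Integrable (fun ω => ‖x - xs ω‖ ^ 2) P := fun x =>
    integrable_norm_sq ((memLp_const x).sub hxs)
  have hsq : ∀ x, ∫ ω, ‖G ω x‖ ^ 2 ∂P ≤ L ^ 2 * ∫ ω, ‖x - xs ω‖ ^ 2 ∂P := fun x => by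
    rw [← integral_const_mul]
    refine integral_mono (integrable_norm_sq (hG2 x)) ((hd x).const_mul _) fun ω => ?_
    rw [← mul_pow]
    exact pow_le_pow_left₀ (norm_nonneg _) ((hG ω).norm_le_of_zero (hzero ω) x) 2
  have hy₀ : ‖y - x₀‖ ^ 2 ≤ L ^ 2 / μ ^ 2 * ∫ ω, ‖x₀ - xs ω‖ ^ 2 ∂P := by
    have hmean := StronglyMonotoneLip.integral hG fun x => (hG2 x).integrable one_le_two
    have := pow_le_pow_left₀ (by positivity) (hmean.mul_norm_sub_zero_le hy x₀) 2
    rw [div_mul_eq_mul_div, le_div_iff₀ (by positivity), norm_sub_rev, mul_comm, ← mul_pow]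
    exact this.trans ((norm_integral_sq_le (hG2 x₀)).trans (hsq x₀))
  have hsplit : ∫ ω, ‖y - xs ω‖ ^ 2 ∂P ≤ 2 * ‖y - x₀‖ ^ 2 + 2 * ∫ ω, ‖x₀ - xs ω‖ ^ 2 ∂P :=
    calc _ ≤ ∫ ω, (2 * ‖y - x₀‖ ^ 2 + 2 * ‖x₀ - xs ω‖ ^ 2) ∂P :=
          integral_mono (hd y) ((integrable_const _).add ((hd x₀).const_mul 2)) fun ω => by
            simpa only [sub_add_sub_cancel] using norm_add_sq_le_two_mul (y - x₀) (x₀ - xs ω)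
      _ = _ := by
          rw [integral_add (integrable_const _) ((hd x₀).const_mul 2), integral_const,
            probReal_univ, one_smul, integral_const_mul]
  calc _ ≤ L ^ 2 * ∫ ω, ‖y - xs ω‖ ^ 2 ∂P := hsq y
    _ ≤ L ^ 2 * (2 * (L ^ 2 / μ ^ 2 * ∫ ω, ‖x₀ - xs ω‖ ^ 2 ∂P) + 2 * ∫ ω, ‖x₀ - xs ω‖ ^ 2 ∂P) := by
        gcongr; linarith
    _ = _ := by ring

end Integral

end StronglyMonotoneLip

end StronglyMonotone

section StronglyConvexSmooth

variable {E : Type*} [NormedAddCommGroup E] [InnerProductSpace ℝ E]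

/-- `φ` is a `μ`-strongly convex function with the `L`-Lipschitz gradient `G`, expressed by the
first-order inequalities between `φ` and `G`, which pass to averages and expectations. -/
structure StronglyConvexSmooth (μ L : ℝ) (φ : E → ℝ) (G : E → E) : Prop
    extends StronglyMonotoneLip μ L G where
  add_inner_le : ∀ x y, φ y + inner ℝ (G y) (x - y) ≤ φ x
  le_add_inner : ∀ x y, φ x ≤ φ y + inner ℝ (G y) (x - y) + L * ‖x - y‖ ^ 2

namespace StronglyConvexSmooth

variable {μ L : ℝ}

protected lemma avg {ι : Type*} [Fintype ι] [Nonempty ι] {φ : ι → E → ℝ} {G : ι → E → E}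
    (h : ∀ i, StronglyConvexSmooth μ L (φ i) (G i)) :
    StronglyConvexSmooth μ L (fun x => avg fun i => φ i x) fun x => avg fun i => G i x where
  toStronglyMonotoneLip := .avg fun i => (h i).toStronglyMonotoneLip
  add_inner_le x y := by
    rw [inner_avg_left, ← avg_add]
    exact avg_mono fun i => (h i).add_inner_le x y
  le_add_inner x y := by
    rw [inner_avg_left, ← avg_add, ← avg_const (ι := ι) (L * ‖x - y‖ ^ 2), ← avg_add]
    exact avg_mono fun i => (h i).le_add_inner x y

protected lemma integral [CompleteSpace E] {Ω : Type*} {mΩ : MeasurableSpace Ω} {P : Measure Ω}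
    [IsProbabilityMeasure P] {φ : Ω → E → ℝ} {G : Ω → E → E}
    (h : ∀ ω, StronglyConvexSmooth μ L (φ ω) (G ω)) (hφ : ∀ x, Integrable (fun ω => φ ω x) P)
    (hG : ∀ x, Integrable (fun ω => G ω x) P) :
    StronglyConvexSmooth μ L (fun x => ∫ ω, φ ω x ∂P) fun x => ∫ ω, G ω x ∂P where
  toStronglyMonotoneLip := .integral (fun ω => (h ω).toStronglyMonotoneLip) hG
  add_inner_le x y := by
    rw [real_inner_comm, ← integral_inner (hG y),
      ← integral_add (hφ y) ((hG y).const_inner (x - y))]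
    refine integral_mono ((hφ y).add ((hG y).const_inner _)) (hφ x) fun ω => ?_
    rw [real_inner_comm]
    exact (h ω).add_inner_le x y
  le_add_inner x y := by
    rw [real_inner_comm, ← integral_inner (hG y),
      ← integral_add (hφ y) ((hG y).const_inner (x - y)), ← sub_le_iff_le_add]
    have hconst : ∫ _, L * ‖x - y‖ ^ 2 ∂P = L * ‖x - y‖ ^ 2 := by simp
    rw [← hconst, ← integral_sub (hφ x) (integrable_const _)]
    refine integral_mono ((hφ x).sub (integrable_const _))
      ((hφ y).add ((hG y).const_inner _)) fun ω => ?_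
    simp only [real_inner_comm _ (x - y)]
    exact sub_le_iff_le_add.2 ((h ω).le_add_inner x y)

variable {φ Φ : E → ℝ} {G Γ : E → E}

protected lemma continuous (h : StronglyConvexSmooth μ L φ G) : Continuous φ :=
  continuous_iff_continuousAt.2 fun y =>
    tendsto_of_tendsto_of_tendsto_of_le_of_le
      (Continuous.tendsto' (f := fun x => φ y + inner ℝ (G y) (x - y)) (by fun_prop) _ _ (by simp))
      (Continuous.tendsto' (f := fun x => φ y + inner ℝ (G y) (x - y) + L * ‖x - y‖ ^ 2)
        (by fun_prop) _ _ (by simp))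
      (fun x => h.add_inner_le x y) fun x => h.le_add_inner x y

lemma abs_le (h : StronglyConvexSmooth μ L φ G) (hL : 0 ≤ L) (x y : E) :
    |φ x| ≤ |φ y| + ‖G y‖ * ‖x - y‖ + L * ‖x - y‖ ^ 2 := by
  have hφy := _root_.abs_le.1 (le_refl |φ y|)
  have hinner := _root_.abs_le.1 (abs_real_inner_le_norm (G y) (x - y))
  have hquad : 0 ≤ L * ‖x - y‖ ^ 2 := by positivity
  exact _root_.abs_le.2
    ⟨by linarith [h.add_inner_le x y], by linarith [h.le_add_inner x y]⟩

lemma sub_le_sub_add (hΦ : StronglyConvexSmooth μ L Φ Γ) (hφ : StronglyConvexSmooth μ L φ G)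
    (hμ : 0 < μ) (hL : 0 ≤ L) {x y : E} (hx : G x = 0) (hy : Γ y = 0) (u : E) :
    Φ u - φ u ≤ Φ y - φ y
      + (2 * L + 1) * (1 + 1 / μ ^ 2) * (‖u - x‖ ^ 2 + ‖G y‖ ^ 2) := by
  have hupper := hΦ.le_add_inner u y
  rw [hy, inner_zero_left, add_zero] at hupper
  have hlower := hφ.add_inner_le u y
  have hinner : -inner ℝ (G y) (u - y) ≤ ‖G y‖ ^ 2 / 2 + ‖u - y‖ ^ 2 / 2 := by
    linarith [neg_le_of_abs_le (abs_real_inner_le_norm (G y) (u - y)),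
      two_mul_le_add_sq ‖G y‖ ‖u - y‖]
  have hzero : ‖x - y‖ ^ 2 ≤ 1 / μ ^ 2 * ‖G y‖ ^ 2 := by
    rw [one_div_mul_eq_div, le_div_iff₀ (by positivity), mul_comm, ← mul_pow, norm_sub_rev]
    exact pow_le_pow_left₀ (by positivity) (hφ.mul_norm_sub_zero_le hx y) 2
  have hdist : ‖u - y‖ ^ 2 ≤ 2 * ‖u - x‖ ^ 2 + 2 * (1 / μ ^ 2 * ‖G y‖ ^ 2) := by
    have := norm_add_sq_le_two_mul (u - x) (x - y)
    rw [sub_add_sub_cancel] at this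
    linarith
  have hscaled := mul_le_mul_of_nonneg_left hdist (by positivity : 0 ≤ L + 1 / 2)
  have hslack : 0 ≤ 1 / μ ^ 2 * ‖u - x‖ ^ 2 * (2 * L + 1) + (2 * L + 1 / 2) * ‖G y‖ ^ 2 := by
    positivity
  linarith

end StronglyConvexSmooth

end StronglyConvexSmooth

section LossGradient

variable {d N Z : ℕ} {Ξ : Type*} {f : Model d → Ξ → ℝ} {μ L : ℝ}

lemma hasGradientAt_avg {ι E : Type*} [Fintype ι] [NormedAddCommGroup E] [InnerProductSpace ℝ E]
    [CompleteSpace E] {F : ι → E → ℝ} {F' : ι → E} {x : E}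
    (h : ∀ i, HasGradientAt (F i) (F' i) x) :
    HasGradientAt (fun y => avg fun i => F i y) (avg F') x := by
  rw [hasGradientAt_iff_hasFDerivAt]
  have hdual : InnerProductSpace.toDual ℝ E (avg F')
      = (1 / (Fintype.card ι : ℝ)) • ∑ i, InnerProductSpace.toDual ℝ E (F' i) := by
    simp [avg, map_sum]
  rw [hdual]
  exact (HasFDerivAt.fun_sum fun i _ => hasGradientAt_iff_hasFDerivAt.1 (h i)).const_smul
    (1 / (Fintype.card ι : ℝ))

lemma meanModel_eq_avg (x : Fin N → Model d) : meanModel x = avg x := by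
  simp only [meanModel, avg, Fintype.card_fin]

lemma localLoss_eq_avg (s : Fin Z → Ξ) (x : Model d) :
    localLoss f s x = avg fun z => f x (s z) := by
  simp only [localLoss, avg, Fintype.card_fin, smul_eq_mul]

lemma empiricalLoss_eq_avg (S : Fin N → Fin Z → Ξ) (x : Model d) :
    empiricalLoss f S x = avg fun n => avg fun z => f x (S n z) := by
  simp only [empiricalLoss, localLoss_eq_avg]
  simp only [avg, Fintype.card_fin, smul_eq_mul]

/-- The gradient `∇f(x; ξ)` of the loss, as a map of the model `x`. -/
noncomputable def lossGrad (f : Model d → Ξ → ℝ) (ξ : Ξ) (x : Model d) : Model d :=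
  gradient (fun u => f u ξ) x

/-- The gradient of the local empirical loss of a dataset `s`. -/
noncomputable def localGrad (f : Model d → Ξ → ℝ) (s : Fin Z → Ξ) (x : Model d) : Model d :=
  avg fun z => lossGrad f (s z) x

/-- The gradient of the global empirical loss of the datasets `S`. -/
noncomputable def empiricalGrad (f : Model d → Ξ → ℝ) (S : Fin N → Fin Z → Ξ) (x : Model d) :
    Model d :=
  avg fun n => localGrad f (S n) x

namespace StronglyConvexLoss

lemma stronglyMonotoneLip_lossGrad (hf : StronglyConvexLoss f μ) (hs : SmoothLoss f L) (ξ : Ξ) :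
    StronglyMonotoneLip μ L (lossGrad f ξ) where
  mono x y := by
    have hxy := (hf ξ).2 x y
    have hyx := (hf ξ).2 y x
    rw [norm_sub_rev y x, ← neg_sub x y, inner_neg_left] at hyx
    rw [real_inner_comm, inner_sub_right, lossGrad, lossGrad]
    linarith
  lip := hs ξ

lemma add_inner_lossGrad_le (hf : StronglyConvexLoss f μ) (hμ : 0 ≤ μ) (ξ : Ξ) (x y : Model d) :
    f y ξ + inner ℝ (lossGrad f ξ y) (x - y) ≤ f x ξ := by
  have h := (hf ξ).2 x y
  have h0 : 0 ≤ μ / 2 * ‖x - y‖ ^ 2 := by positivity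
  rw [real_inner_comm, lossGrad]
  linarith

lemma stronglyConvexSmooth (hf : StronglyConvexLoss f μ) (hs : SmoothLoss f L) (hμ : 0 ≤ μ)
    (ξ : Ξ) : StronglyConvexSmooth μ L (fun x => f x ξ) (lossGrad f ξ) where
  toStronglyMonotoneLip := hf.stronglyMonotoneLip_lossGrad hs ξ
  add_inner_le := hf.add_inner_lossGrad_le hμ ξ
  le_add_inner x y := by
    have hconv := hf.add_inner_lossGrad_le hμ ξ y x
    have hlip : inner ℝ (lossGrad f ξ x - lossGrad f ξ y) (x - y) ≤ L * ‖x - y‖ ^ 2 :=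
      calc _ ≤ ‖lossGrad f ξ x - lossGrad f ξ y‖ * ‖x - y‖ := real_inner_le_norm _ _
        _ ≤ L * ‖x - y‖ * ‖x - y‖ := by gcongr; exact hs ξ x y
        _ = L * ‖x - y‖ ^ 2 := by ring
    rw [← neg_sub x y, inner_neg_right] at hconv
    rw [inner_sub_left] at hlip
    linarith

lemma stronglyConvexSmooth_empiricalLoss [NeZero N] [NeZero Z] (hf : StronglyConvexLoss f μ)
    (hs : SmoothLoss f L) (hμ : 0 ≤ μ) (S : Fin N → Fin Z → Ξ) :
    StronglyConvexSmooth μ L (empiricalLoss f S) (empiricalGrad f S) := by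
  rw [funext (empiricalLoss_eq_avg (f := f) S)]
  exact .avg fun n => .avg fun z => hf.stronglyConvexSmooth hs hμ (S n z)

lemma hasGradientAt_localLoss (hf : StronglyConvexLoss f μ) (s : Fin Z → Ξ) (x : Model d) :
    HasGradientAt (localLoss f s) (localGrad f s x) x := by
  rw [funext (localLoss_eq_avg (f := f) s)]
  exact hasGradientAt_avg fun z => ((hf (s z)).1 x).hasGradientAt

lemma hasGradientAt_empiricalLoss (hf : StronglyConvexLoss f μ) (S : Fin N → Fin Z → Ξ)
    (x : Model d) : HasGradientAt (empiricalLoss f S) (empiricalGrad f S x) x := by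
  rw [funext (empiricalLoss_eq_avg (f := f) S)]
  simp only [← localLoss_eq_avg]
  exact hasGradientAt_avg fun n => hf.hasGradientAt_localLoss (S n) x

lemma empiricalGrad_eq_zero (hf : StronglyConvexLoss f μ) {S : Fin N → Fin Z → Ξ} {x : Model d}
    (hx : ∀ y, empiricalLoss f S x ≤ empiricalLoss f S y) : empiricalGrad f S x = 0 := by
  have hmin : IsLocalMin (empiricalLoss f S) x := .of_forall hx
  simpa using hmin.hasFDerivAt_eq_zero (hf.hasGradientAt_empiricalLoss S x).hasFDerivAt

end StronglyConvexLoss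

lemma BoundedNoise.avg_norm_lossGrad_sub_localGrad_sq_le {S : Fin N → Fin Z → Ξ} {σ : ℝ}
    (hσ : BoundedNoise f S σ) (hf : StronglyConvexLoss f μ) (x : Model d) (n : Fin N) :
    avg (fun z => ‖lossGrad f (S n z) x - localGrad f (S n) x‖ ^ 2) ≤ σ ^ 2 := by
  have h := hσ x n
  rw [(hf.hasGradientAt_localLoss _ x).gradient] at h
  simpa only [lossGrad, avg, Fintype.card_fin, smul_eq_mul] using h

lemma BoundedHeterogeneity.avg_norm_localGrad_sub_sq_le {S : Fin N → Fin Z → Ξ} {δ : ℝ}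
    (hδ : BoundedHeterogeneity f S δ) (hf : StronglyConvexLoss f μ) (x : Model d) :
    avg (fun n => ‖localGrad f (S n) x - empiricalGrad f S x‖ ^ 2) ≤ δ ^ 2 := by
  have h := hδ x
  simp only [(hf.hasGradientAt_localLoss _ x).gradient,
    (hf.hasGradientAt_empiricalLoss _ x).gradient] at h
  simpa only [avg, Fintype.card_fin, smul_eq_mul] using h

end LossGradient

section Mixing

variable {ι E : Type*} [Fintype ι] [NormedAddCommGroup E] [InnerProductSpace ℝ E]

lemma sum_norm_matrix_smul_sq_le [FiniteDimensional ℝ E] [DecidableEq ι] (M : Matrix ι ι ℝ)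
    (u : ι → E) : ∑ i, ‖∑ j, M i j • u j‖ ^ 2
      ≤ ‖Matrix.toEuclideanCLM (n := ι) (𝕜 := ℝ) M‖ ^ 2 * ∑ j, ‖u j‖ ^ 2 := by
  set b := stdOrthonormalBasis ℝ E
  have hcoord : ∀ l, ∑ i, (∑ j, M i j * inner ℝ (b l) (u j)) ^ 2
      ≤ ‖Matrix.toEuclideanCLM (n := ι) (𝕜 := ℝ) M‖ ^ 2 * ∑ j, inner ℝ (b l) (u j) ^ 2 :=
    fun l => by
      have h := pow_le_pow_left₀ (norm_nonneg _)
        ((Matrix.toEuclideanCLM (n := ι) (𝕜 := ℝ) M).le_opNorm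
          (WithLp.toLp 2 fun j => inner ℝ (b l) (u j))) 2
      rw [mul_pow, EuclideanSpace.real_norm_sq_eq, EuclideanSpace.real_norm_sq_eq] at h
      simpa [Matrix.ofLp_toEuclideanCLM, Matrix.mulVec, dotProduct] using h
  simp only [← b.sum_sq_norm_inner_right, Real.norm_eq_abs, sq_abs, inner_sum, inner_smul_right]
  rw [Finset.sum_comm, Finset.sum_comm (s := Finset.univ (α := ι)), Finset.mul_sum]
  exact Finset.sum_le_sum fun l _ => hcoord l

lemma sum_smul_sub {w : ι → ℝ} (hw : ∑ j, w j = 1) (u : ι → E) (c : E) :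
    ∑ j, w j • (u j - c) = ∑ j, w j • u j - c := by
  simp only [smul_sub, Finset.sum_sub_distrib, ← Finset.sum_smul, hw, one_smul]

end Mixing

section RobustAggregation

variable {d N B : ℕ} {W : Matrix (Fin N) (Fin N) ℝ}

lemma dispersion_mix_le [NeZero N] (hW : ∀ n, ∑ m, W n m = 1) (u : Fin N → Model d) :
    dispersion (fun n => ∑ m, W n m • u m) ≤ (1 - mixingGap W) * dispersion u := by
  let M := (1 - (1 / (N : ℝ)) • Matrix.of (fun _ _ => (1 : ℝ))) * W
  have hM : ∀ n, ∑ m, M n m • (u m - avg u)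
      = ∑ m, W n m • u m - avg fun n' => ∑ m, W n' m • u m := fun n => by
    have hMW : ∀ m, M n m = W n m - (1 / (N : ℝ)) * ∑ n', W n' m := fun m => by
      simp [M, sub_mul, Matrix.mul_apply, Finset.mul_sum]
    have hcentre : (1 / (N : ℝ)) • ∑ m, (∑ n', W n' m) • (u m - avg u)
        = avg fun n' => ∑ m, W n' m • (u m - avg u) := by
      simp only [avg, Fintype.card_fin, Finset.sum_smul]
      rw [Finset.sum_comm]
    simp only [hMW, sub_smul, Finset.sum_sub_distrib, mul_smul]
    rw [← Finset.smul_sum, hcentre]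
    simp only [sum_smul_sub (hW _), avg_sub_const, sub_sub_sub_cancel_right]
  have h := sum_norm_matrix_smul_sq_le M fun m => u m - avg u
  simp only [hM] at h
  have hdisp : ∀ v : Fin N → Model d, dispersion v = 1 / (N : ℝ) * ∑ n, ‖v n - avg v‖ ^ 2 :=
    fun v => by
      rw [dispersion, avg.eq_def fun i => ‖v i - avg v‖ ^ 2, Fintype.card_fin, smul_eq_mul]
  rw [mixingGap, sub_sub_cancel, hdisp, hdisp, mul_left_comm]
  exact mul_le_mul_of_nonneg_left h (by positivity)

lemma norm_avg_mix_sub_avg_sq_le (hW : ∀ n, ∑ m, W n m = 1) (u : Fin N → Model d) :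
    ‖avg (fun n => ∑ m, W n m • u m) - avg u‖ ^ 2 ≤ chiSq W * dispersion u := by
  set c : Fin N → ℝ := fun m => ∑ n, W n m - 1
  have hc : ∑ m, c m = 0 := by
    simp only [c, Finset.sum_sub_distrib]
    rw [Finset.sum_comm]
    simp [hW]
  have hsum : ∑ m, c m • (u m - avg u) = ∑ n, (∑ m, W n m • u m - u n) := by
    simp only [smul_sub, Finset.sum_sub_distrib, ← Finset.sum_smul, hc, zero_smul, sub_zero]
    simp only [c, sub_smul, one_smul, Finset.sum_sub_distrib, Finset.sum_smul]
    rw [Finset.sum_comm]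
  have hdrift : avg (fun n => ∑ m, W n m • u m) - avg u = avg fun m => c m • (u m - avg u) := by
    rw [← avg_sub]
    exact congrArg ((1 / (Fintype.card (Fin N) : ℝ)) • ·) hsum.symm
  calc _ ≤ avg (fun m => |c m| * ‖u m - avg u‖) ^ 2 := by
        rw [hdrift]
        gcongr
        simpa only [norm_smul, Real.norm_eq_abs] using norm_avg_le fun m => c m • (u m - avg u)
    _ ≤ (1 / (N : ℝ)) ^ 2 * ((∑ m, |c m| ^ 2) * ∑ m, ‖u m - avg u‖ ^ 2) := by
        rw [avg, smul_eq_mul, mul_pow, Fintype.card_fin]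
        gcongr
        exact Finset.sum_mul_sq_le_sq_mul_sq Finset.univ _ _
    _ = chiSq W * dispersion u := by
        simp only [sq_abs, chiSq, dispersion, avg, Fintype.card_fin, smul_eq_mul, c]
        ring

lemma mixingGap_le_one (W : Matrix (Fin N) (Fin N) ℝ) : mixingGap W ≤ 1 :=
  sub_le_self _ (sq_nonneg _)

lemma chiSq_nonneg (W : Matrix (Fin N) (Fin N) ℝ) : 0 ≤ chiSq W := by
  unfold chiSq; positivity

namespace IsVirtualMixing

variable {G : SimpleGraph (Fin N ⊕ Fin B)} {A : (n : Fin N) → AggregationRule G d n} {ρ lam : ℝ}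

lemma norm_mix_sub_le (hA : IsVirtualMixing G A W ρ) {u : Fin N → Model d} {c : Model d} {r : ℝ}
    (hu : ∀ m, ‖u m - c‖ ≤ r) (n : Fin N) : ‖∑ m, W n m • u m - c‖ ≤ r := by
  rw [← sum_smul_sub (hA.row_sum n)]
  calc _ ≤ ∑ m, ‖W n m • (u m - c)‖ := norm_sum_le _ _
    _ ≤ ∑ m, W n m * r := by
        refine Finset.sum_le_sum fun m _ => ?_
        rw [norm_smul, Real.norm_of_nonneg (hA.weight_mem n m).1]
        exact mul_le_mul_of_nonneg_left (hu m) (hA.weight_mem n m).1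
    _ = r := by rw [← Finset.sum_mul, hA.row_sum, one_mul]

lemma norm_sub_mix_le (hA : IsVirtualMixing G A W ρ) {u : Fin N → Model d} {c : Model d} {r : ℝ}
    (hu : ∀ m, ‖u m - c‖ ≤ r) (v : Fin B → Model d) (n : Fin N) :
    ‖A n (u n) (fun m => Sum.elim u v m.1) - ∑ m, W n m • u m‖ ≤ ρ * (2 * r) := by
  refine (hA.contraction n u v).trans (mul_le_mul_of_nonneg_left ?_ hA.rho_nonneg)
  refine Real.iSup_le (fun m => ?_) (by linarith [(norm_nonneg _).trans (hu n)])
  calc ‖u m.1 - ∑ m', W n m' • u m'‖ ≤ ‖u m.1 - c‖ + ‖∑ m', W n m' • u m' - c‖ := by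
        rw [← sub_sub_sub_cancel_right _ _ c]
        exact norm_sub_le _ _
    _ ≤ 2 * r := by linarith [hu m.1, hA.norm_mix_sub_le hu n]

lemma norm_sub_mix_sq_le (hA : IsVirtualMixing G A W ρ) (u : Fin N → Model d)
    (v : Fin B → Model d) (n : Fin N) :
    ‖A n (u n) (fun m => Sum.elim u v m.1) - ∑ m, W n m • u m‖ ^ 2
      ≤ 4 * ρ ^ 2 * N * dispersion u := by
  have hdev : ∀ m, ‖u m - avg u‖ ≤ √(N * dispersion u) := fun m =>
    Real.le_sqrt_of_sq_le (by simpa using norm_sub_avg_sq_le u m)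
  calc _ ≤ (ρ * (2 * √(N * dispersion u))) ^ 2 := by gcongr; exact hA.norm_sub_mix_le hdev v n
    _ = 4 * ρ ^ 2 * √(N * dispersion u) ^ 2 := by ring
    _ = 4 * ρ ^ 2 * N * dispersion u := by
        rw [Real.sq_sqrt (mul_nonneg N.cast_nonneg (dispersion_nonneg u))]; ring

lemma norm_aggregate_le (hA : IsVirtualMixing G A W ρ) (u : Fin N → Model d)
    (v : Fin B → Model d) (n : Fin N) :
    ‖A n (u n) (fun m => Sum.elim u v m.1)‖ ≤ (2 * ρ + 1) * ∑ m, ‖u m‖ := by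
  have hu : ∀ m, ‖u m - 0‖ ≤ ∑ m', ‖u m'‖ := fun m => by
    rw [sub_zero]
    exact Finset.single_le_sum (fun _ _ => norm_nonneg _) (Finset.mem_univ m)
  have hmix := hA.norm_mix_sub_le hu n
  have hdist := hA.norm_sub_mix_le hu v n
  rw [sub_zero] at hmix
  linarith [norm_le_norm_sub_add (A n (u n) (fun m => Sum.elim u v m.1)) (∑ m, W n m • u m)]

lemma four_mul_rho_sq_mul_card_le [NeZero N] (hA : IsVirtualMixing G A W ρ)
    (hρ : ρ < lam / (8 * √(N : ℝ))) : 4 * ρ ^ 2 * N ≤ lam ^ 2 / 16 := by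
  have hN : (0 : ℝ) < √N := Real.sqrt_pos.2 (Nat.cast_pos.2 (NeZero.pos N))
  have h : ρ * √(N : ℝ) ≤ lam / 8 := by
    have := (lt_div_iff₀ (by positivity)).1 hρ; linarith
  have hsq := pow_le_pow_left₀ (mul_nonneg hA.rho_nonneg hN.le) h 2
  rw [mul_pow, Real.sq_sqrt N.cast_nonneg] at hsq
  linarith

variable [NeZero N] (hA : IsVirtualMixing G A W ρ) (u : Fin N → Model d)
  (v : Fin N → Fin B → Model d)

include hA

lemma avg_norm_sub_mix_sq_le :
    avg (fun n => ‖A n (u n) (fun m => Sum.elim u (v n) m.1) - ∑ m, W n m • u m‖ ^ 2)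
      ≤ 4 * ρ ^ 2 * N * dispersion u :=
  avg_le_of_forall_le fun n => hA.norm_sub_mix_sq_le u (v n) n

lemma dispersion_aggregate_le (hlam : 0 < lam) (hgap : mixingGap W = lam)
    (hρ : ρ < lam / (8 * √(N : ℝ))) :
    dispersion (fun n => A n (u n) (fun m => Sum.elim u (v n) m.1))
      ≤ (1 - lam / 4) * dispersion u := by
  set e : Fin N → Model d :=
    fun n => A n (u n) (fun m => Sum.elim u (v n) m.1) - ∑ m, W n m • u m with he
  have hu := dispersion_nonneg u
  have herror : dispersion e ≤ lam ^ 2 / 16 * dispersion u :=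
    calc dispersion e ≤ avg fun n => ‖e n - 0‖ ^ 2 := dispersion_le_avg_norm_sub_sq e 0
      _ ≤ 4 * ρ ^ 2 * N * dispersion u := by
          simpa only [sub_zero] using hA.avg_norm_sub_mix_sq_le u v
      _ ≤ lam ^ 2 / 16 * dispersion u := by gcongr; exact hA.four_mul_rho_sq_mul_card_le hρ
  have hmix : dispersion (fun n => ∑ m, W n m • u m) ≤ (1 - lam) * dispersion u :=
    hgap ▸ dispersion_mix_le hA.row_sum u
  calc _ = dispersion fun n => ∑ m, W n m • u m + e n := by simp only [he, add_sub_cancel]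
    _ ≤ (1 + lam / 2) * dispersion (fun n => ∑ m, W n m • u m)
          + (1 + 1 / (lam / 2)) * dispersion e := dispersion_add_le _ e (half_pos hlam)
    _ ≤ (1 + lam / 2) * ((1 - lam) * dispersion u)
          + (1 + 1 / (lam / 2)) * (lam ^ 2 / 16 * dispersion u) := by gcongr
    _ = ((1 + lam / 2) * (1 - lam) + (lam ^ 2 / 16 + lam / 8)) * dispersion u := by
        field_simp; ring
    _ ≤ (1 - lam / 4) * dispersion u := by gcongr; nlinarith

lemma norm_avg_aggregate_sub_avg_sq_le :
    ‖avg (fun n => A n (u n) (fun m => Sum.elim u (v n) m.1)) - avg u‖ ^ 2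
      ≤ 2 * (4 * ρ ^ 2 * N + chiSq W) * dispersion u := by
  set e : Fin N → Model d :=
    fun n => A n (u n) (fun m => Sum.elim u (v n) m.1) - ∑ m, W n m • u m with he
  have hsplit : avg (fun n => A n (u n) (fun m => Sum.elim u (v n) m.1)) - avg u
      = avg e + (avg (fun n => ∑ m, W n m • u m) - avg u) := by
    rw [he, avg_sub, sub_add_sub_cancel]
  calc _ ≤ 2 * ‖avg e‖ ^ 2 + 2 * ‖avg (fun n => ∑ m, W n m • u m) - avg u‖ ^ 2 := by
        rw [hsplit]; exact norm_add_sq_le_two_mul _ _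
    _ ≤ 2 * (4 * ρ ^ 2 * N * dispersion u) + 2 * (chiSq W * dispersion u) := by
        gcongr
        · exact (norm_avg_sq_le e).trans (hA.avg_norm_sub_mix_sq_le u v)
        · exact norm_avg_mix_sub_avg_sq_le hA.row_sum u
    _ = _ := by ring

end IsVirtualMixing

end RobustAggregation

section UniformDraw

variable {ι Ω E : Type*} [Fintype ι]

/-- A random index `J`, uniformly distributed on `ι` and independent of the past `m`. -/
structure IsUniformDraw [MeasurableSpace ι] (m : MeasurableSpace Ω) {mΩ : MeasurableSpace Ω}
    (J : Ω → ι) (P : Measure Ω) : Prop where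
  le : m ≤ mΩ
  measurable : Measurable J
  real_preimage_singleton : ∀ i, P.real (J ⁻¹' {i}) = 1 / Fintype.card ι
  indep : Indep (MeasurableSpace.comap J inferInstance) m P

lemma stronglyMeasurable_avg [NormedAddCommGroup E] [NormedSpace ℝ E] {_ : MeasurableSpace Ω}
    {φ : ι → Ω → E} (hφ : ∀ i, StronglyMeasurable (φ i)) :
    StronglyMeasurable fun ω => avg fun i => φ i ω :=
  (Finset.stronglyMeasurable_fun_sum Finset.univ fun i _ => hφ i).const_smul _

lemma sum_indicator_preimage_singleton [AddCommMonoid E] (J : Ω → ι) (φ : ι → Ω → E) :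
    (fun ω => φ (J ω) ω) = fun ω => ∑ i, (J ⁻¹' {i}).indicator (φ i) ω := by
  classical
  funext ω
  simp [Set.indicator_apply]

namespace IsUniformDraw

variable [MeasurableSpace ι] [MeasurableSingletonClass ι] {m mΩ : MeasurableSpace Ω} {P : Measure Ω}
  {J : Ω → ι}

lemma measurableSet_preimage (hJ : IsUniformDraw m J P) (i : ι) : MeasurableSet (J ⁻¹' {i}) :=
  hJ.measurable (measurableSet_singleton i)

lemma memLp_comp [NormedAddCommGroup E] (hJ : IsUniformDraw m J P) {p : ENNReal} {φ : ι → Ω → E}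
    (hφ : ∀ i, MemLp (φ i) p P) : MemLp (fun ω => φ (J ω) ω) p P := by
  rw [sum_indicator_preimage_singleton]
  exact memLp_finsetSum Finset.univ fun i _ => (hφ i).indicator (hJ.measurableSet_preimage i)

lemma integral_comp [NormedAddCommGroup E] [NormedSpace ℝ E] [CompleteSpace E]
    [IsProbabilityMeasure P] (hJ : IsUniformDraw m J P) {φ : ι → Ω → E}
    (hφm : ∀ i, StronglyMeasurable[m] (φ i)) (hφ : ∀ i, Integrable (φ i) P) :
    ∫ ω, φ (J ω) ω ∂P = ∫ ω, avg (fun i => φ i ω) ∂P := by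
  have hset : ∀ i, ∫ ω in J ⁻¹' {i}, φ i ω ∂P = (1 / (Fintype.card ι : ℝ)) • ∫ ω, φ i ω ∂P :=
    fun i => by
      have hle := hJ.measurable.comap_le
      have hJi : MeasurableSet[MeasurableSpace.comap J inferInstance] (J ⁻¹' {i}) :=
        ⟨{i}, measurableSet_singleton i, rfl⟩
      rw [← setIntegral_condExp hle (hφ i) hJi, setIntegral_congr_ae (hle _ hJi)
        ((condExp_indep_eq hJ.le hle (hφm i) hJ.indep.symm).mono fun ω h _ => h),
        setIntegral_const, hJ.real_preimage_singleton]
  rw [integral_avg hφ, sum_indicator_preimage_singleton,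
    integral_finsetSum _ fun i _ => (hφ i).indicator (hJ.measurableSet_preimage i)]
  simp only [integral_indicator (hJ.measurableSet_preimage _), hset, avg, Finset.smul_sum]

variable [NormedAddCommGroup E] [InnerProductSpace ℝ E] [IsProbabilityMeasure P] {φ : ι → Ω → E}

lemma integral_inner_sub_avg [Nonempty ι] (hJ : IsUniformDraw m J P)
    (hφm : ∀ i, StronglyMeasurable[m] (φ i)) (hφ : ∀ i, MemLp (φ i) 2 P) {v : Ω → E}
    (hvm : StronglyMeasurable[m] v) (hv : MemLp v 2 P) :
    ∫ ω, inner ℝ (φ (J ω) ω - avg fun i => φ i ω) (v ω) ∂P = 0 := by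
  rw [hJ.integral_comp (φ := fun j ω => inner ℝ (φ j ω - avg fun i => φ i ω) (v ω))
    (fun i => ((hφm i).sub (stronglyMeasurable_avg hφm)).inner hvm)
    fun i => integrable_inner ((hφ i).sub (memLp_avg hφ)) hv]
  simp only [← inner_avg_left, avg_sub_const, sub_self, inner_zero_left, integral_zero]

lemma integral_norm_sub_avg_sq (hJ : IsUniformDraw m J P) (hφm : ∀ i, StronglyMeasurable[m] (φ i))
    (hφ : ∀ i, MemLp (φ i) 2 P) :
    ∫ ω, ‖φ (J ω) ω - avg fun i => φ i ω‖ ^ 2 ∂P = ∫ ω, dispersion (fun i => φ i ω) ∂P :=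
  hJ.integral_comp (φ := fun j ω => ‖φ j ω - avg fun i => φ i ω‖ ^ 2)
    (fun i => ((hφm i).sub (stronglyMeasurable_avg hφm)).norm.pow 2)
    fun i => integrable_norm_sq ((hφ i).sub (memLp_avg hφ))

end IsUniformDraw

lemma IsByzantineSetup.isUniformDraw {N B Z d : ℕ} {Ξ : Type*} [MeasurableSpace Ξ]
    {mΩ : MeasurableSpace Ω} {P : Measure Ω} {𝓕 : Filtration ℕ mΩ} {D : Fin N → Measure Ξ}
    {S : Ω → Fin N → Fin Z → Ξ} {idx : ℕ → Ω → Fin N → Fin Z}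
    {byz : ℕ → Fin B → Fin N → Ω → Model d} (h : IsByzantineSetup P 𝓕 D S idx byz)
    (k : ℕ) (n : Fin N) : IsUniformDraw (𝓕 k) (fun ω => idx k ω n) P where
  le := 𝓕.le k
  measurable := (measurable_pi_apply n).comp ((h.idx_meas k).mono (𝓕.le _) le_rfl)
  indep := by
    refine indep_of_indep_of_le_left (h.idx_indep k) ?_
    rw [show (fun ω => idx k ω n) = (fun j => j n) ∘ idx k from rfl, ← MeasurableSpace.comap_comp]
    exact MeasurableSpace.comap_mono (measurable_pi_apply n).comap_le
  real_preimage_singleton z := by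
    classical
    obtain ⟨M, rfl⟩ : ∃ M, N = M + 1 := ⟨N - 1, (Nat.sub_add_cancel n.pos).symm⟩
    have hZ : (Z : ℝ) ≠ 0 := by exact_mod_cast z.pos.ne'
    have hcard : (Finset.univ.filter fun j : Fin (M + 1) → Fin Z => j n = z).card = Z ^ M := by
      simpa using Fintype.card_filter_piFinset_const_eq_of_mem Finset.univ n (Finset.mem_univ z)
    have hunion : (fun ω => idx k ω n) ⁻¹' {z}
        = ⋃ j ∈ Finset.univ.filter fun j : Fin (M + 1) → Fin Z => j n = z, {ω | idx k ω = j} := by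
      ext ω; simp
    rw [hunion, measureReal_def, measure_biUnion_finset (f := fun j => {ω | idx k ω = j})
      (fun i _ j _ hij => Set.disjoint_left.2 fun ω hi hj => hij (hi.symm.trans hj))
      fun j _ => 𝓕.le _ _ (h.idx_meas k (measurableSet_singleton j))]
    simp only [h.idx_uniform k, Finset.sum_const, hcard, nsmul_eq_mul, Nat.cast_pow,
      ENNReal.toReal_mul, ENNReal.toReal_inv, ENNReal.toReal_pow, ENNReal.toReal_natCast,
      Fintype.card_fin, pow_succ]
    field_simp

end UniformDraw

section GradientStep

variable {ι E : Type*} [Fintype ι] [NormedAddCommGroup E] [InnerProductSpace ℝ E]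

/-- The models after one gradient step with step size `α`, in which agent `i` uses the gradient
map `G i`. -/
def gradientStep (α : ℝ) (G : ι → E → E) (x : ι → E) (i : ι) : E :=
  x i - α • G i (x i)

lemma avg_gradientStep (α : ℝ) (G : ι → E → E) (x : ι → E) :
    avg (gradientStep α G x) = avg x - α • avg fun i => G i (x i) := by
  rw [← avg_smul, ← avg_sub]; rfl

variable [Nonempty ι] {G : ι → E → E} {μ L α : ℝ}

lemma dispersion_comp_le (hG : ∀ i x y, ‖G i x - G i y‖ ≤ L * ‖x - y‖) (x h : ι → E) :
    dispersion (fun i => G i (x i))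
      ≤ 3 * (L ^ 2 * dispersion x + avg (fun i => ‖G i (avg x) - h i‖ ^ 2) + dispersion h) := by
  refine (dispersion_le_avg_norm_sub_sq _ (avg h)).trans ?_
  simp only [dispersion, ← avg_const_mul, ← avg_add]
  refine avg_mono fun i => ?_
  have hlip : ‖G i (x i) - G i (avg x)‖ ^ 2 ≤ L ^ 2 * ‖x i - avg x‖ ^ 2 := by
    rw [← mul_pow]; gcongr; exact hG i _ _
  have h3 := norm_add_three_sq_le (G i (x i) - G i (avg x)) (G i (avg x) - h i) (h i - avg h)
  rw [sub_add_sub_cancel, sub_add_sub_cancel] at h3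
  linarith

lemma dispersion_gradientStep_le (hG : ∀ i x y, ‖G i x - G i y‖ ≤ L * ‖x - y‖) {lam : ℝ}
    (hlam : 0 < lam) (hα : (1 + 16 / lam) * (3 * α ^ 2 * L ^ 2) ≤ lam / 16) (x h : ι → E) :
    dispersion (gradientStep α G x) ≤ (1 + lam / 8) * dispersion x
      + 3 * (1 + 16 / lam) * α ^ 2 * (avg (fun i => ‖G i (avg x) - h i‖ ^ 2) + dispersion h) := by
  have hadd := dispersion_add_le x (fun i => -α • G i (x i)) (η := lam / 16) (by positivity)
  have hsmul : dispersion (fun i => -α • G i (x i)) = α ^ 2 * dispersion fun i => G i (x i) := by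
    simp only [dispersion, avg_smul, ← smul_sub, norm_smul, mul_pow, norm_neg, Real.norm_eq_abs,
      sq_abs, avg_const_mul]
  have hcomp := mul_le_mul_of_nonneg_left (dispersion_comp_le hG x h)
    (by positivity : 0 ≤ (1 + 16 / lam) * α ^ 2)
  have hstep := mul_le_mul_of_nonneg_right hα (dispersion_nonneg x)
  rw [hsmul, one_div_div] at hadd
  simp only [neg_smul, ← sub_eq_add_neg] at hadd
  change dispersion (fun i => x i - α • G i (x i)) ≤ _
  linarith

lemma norm_avg_gradientStep_sub_sq_le (hG : ∀ i, StronglyMonotoneLip μ L (G i)) (hα : 0 ≤ α)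
    (hαL : α * L ^ 2 ≤ μ) {y : E} (hy : avg (fun i => G i y) = 0) {τ : ℝ} (hτ : 0 < τ)
    (x : ι → E) :
    ‖avg (gradientStep α G x) - y‖ ^ 2
      ≤ (1 + τ) * ((1 - α * μ) * ‖avg x - y‖ ^ 2)
        + (1 + 1 / τ) * (α ^ 2 * (L ^ 2 * dispersion x)) := by
  have hsplit : avg (gradientStep α G x) - y
      = ((avg x - α • avg fun i => G i (avg x)) - (y - α • avg fun i => G i y))
        + α • avg fun i => G i (avg x) - G i (x i) := by
    rw [avg_gradientStep, hy, avg_sub]; module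
  have herr : ‖avg fun i => G i (avg x) - G i (x i)‖ ^ 2 ≤ L ^ 2 * dispersion x := by
    refine (norm_avg_sq_le _).trans ?_
    rw [dispersion, ← avg_const_mul]
    refine avg_mono fun i => ?_
    rw [← mul_pow, norm_sub_rev (x i)]
    exact pow_le_pow_left₀ (norm_nonneg _) ((hG i).lip _ _) 2
  rw [hsplit]
  refine (norm_add_sq_le_young _ _ hτ).trans ?_
  rw [norm_smul, mul_pow, Real.norm_eq_abs, sq_abs]
  gcongr
  exact (StronglyMonotoneLip.avg hG).norm_step_sub_step_sq_le hα hαL (avg x) y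

end GradientStep

section GradientOracle

variable {ι ζ Ω E : Type*} [Fintype ι] [Fintype ζ] [NormedAddCommGroup E] [InnerProductSpace ℝ E]
  [MeasurableSpace E]

/-- A random family of gradient maps known to the past `m`: `g ω i j` is the gradient of the loss at
the sample number `j` of agent `i`. Its average over all samples vanishes at `xs ω`, the gradients
of one agent have dispersion at most `σ²`, and their averages over the samples have dispersion at
most `δ²` over the agents. -/
structure IsGradientOracle (m : MeasurableSpace Ω) {mΩ : MeasurableSpace Ω} (P : Measure Ω)
    (μ L σ δ : ℝ) (g : Ω → ι → ζ → E → E) (xs : Ω → E) : Prop where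
  le : m ≤ mΩ
  stronglyMonotoneLip : ∀ ω i j, StronglyMonotoneLip μ L (g ω i j)
  measurable : ∀ i j x, Measurable[m] fun ω => g ω i j x
  noise : ∀ᵐ ω ∂P, ∀ x i, dispersion (fun j => g ω i j x) ≤ σ ^ 2
  heterogeneity : ∀ᵐ ω ∂P, ∀ x, dispersion (fun i => avg fun j => g ω i j x) ≤ δ ^ 2
  measurable_zero : Measurable[m] xs
  avg_zero : ∀ ω, avg (fun i => avg fun j => g ω i j (xs ω)) = 0
  memLp_zero : MemLp xs 2 P

namespace IsGradientOracle

variable {m mΩ : MeasurableSpace Ω} {P : Measure Ω} {μ L σ δ : ℝ} {g : Ω → ι → ζ → E → E}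
  {xs u : Ω → E}

lemma mono (h : IsGradientOracle m P μ L σ δ g xs) {m' : MeasurableSpace Ω} (hm : m ≤ m')
    (hm' : m' ≤ mΩ) : IsGradientOracle m' P μ L σ δ g xs where
  le := hm'
  stronglyMonotoneLip := h.stronglyMonotoneLip
  measurable i j x := (h.measurable i j x).mono hm le_rfl
  noise := h.noise
  heterogeneity := h.heterogeneity
  measurable_zero := h.measurable_zero.mono hm le_rfl
  avg_zero := h.avg_zero
  memLp_zero := h.memLp_zero

lemma ae_avg_avg_norm_sub_sq_le [Nonempty ι] [Nonempty ζ] (h : IsGradientOracle m P μ L σ δ g xs) :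
    ∀ᵐ ω ∂P, ∀ x, avg (fun i => avg fun j => ‖g ω i j x - avg fun i => avg fun j => g ω i j x‖ ^ 2)
      ≤ σ ^ 2 + δ ^ 2 := by
  filter_upwards [h.noise, h.heterogeneity] with ω hσ hδ x
  simp only [avg_norm_sub_sq_eq, avg_add]
  exact add_le_add (avg_le_of_forall_le (hσ x)) (by simpa using hδ x)

lemma integral_dispersion_le [IsProbabilityMeasure P] (h : IsGradientOracle m P μ L σ δ g xs)
    (i : ι) (u : Ω → E) : ∫ ω, dispersion (fun j => g ω i j (u ω)) ∂P ≤ σ ^ 2 := by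
  simpa using integral_mono_of_nonneg (.of_forall fun ω => dispersion_nonneg _)
    (integrable_const (σ ^ 2)) (h.noise.mono fun ω hω => hω (u ω) i)

lemma integral_norm_avg_meanStep_sub_sq_le [Nonempty ι] [Nonempty ζ]
    (h : IsGradientOracle m P μ L σ δ g xs) {X : Ω → ι → E} (hX : ∀ i, MemLp (fun ω => X ω i) 2 P)
    {α τ : ℝ} (hα : 0 ≤ α) (hαL : α * L ^ 2 ≤ μ) (hτ : 0 < τ)
    (hstep : MemLp (fun ω =>
      avg (gradientStep α (fun i x => avg fun j => g ω i j x) (X ω)) - xs ω) 2 P) :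
    ∫ ω, ‖avg (gradientStep α (fun i x => avg fun j => g ω i j x) (X ω)) - xs ω‖ ^ 2 ∂P
      ≤ (1 + τ) * ((1 - α * μ) * ∫ ω, ‖avg (X ω) - xs ω‖ ^ 2 ∂P)
        + (1 + 1 / τ) * (α ^ 2 * (L ^ 2 * ∫ ω, dispersion (X ω) ∂P)) := by
  have hdist_int : Integrable (fun ω =>
      (1 + τ) * ((1 - α * μ) * ‖avg (X ω) - xs ω‖ ^ 2)) P :=
    ((integrable_norm_sq ((memLp_avg hX).sub h.memLp_zero)).const_mul _).const_mul _
  have hdisp_int : Integrable (fun ω =>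
      (1 + 1 / τ) * (α ^ 2 * (L ^ 2 * dispersion (X ω)))) P :=
    (((integrable_dispersion hX).const_mul _).const_mul _).const_mul _
  simp only [← integral_const_mul]
  rw [← integral_add hdist_int hdisp_int]
  exact integral_mono (integrable_norm_sq hstep) (hdist_int.add hdisp_int) fun ω =>
    norm_avg_gradientStep_sub_sq_le (fun i => .avg (h.stronglyMonotoneLip ω i)) hα hαL
      (h.avg_zero ω) hτ (X ω)

variable [BorelSpace E] [SecondCountableTopology E]

lemma measurable_comp (h : IsGradientOracle m P μ L σ δ g xs) (hu : Measurable[m] u) (i : ι)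
    (j : ζ) : Measurable[m] fun ω => g ω i j (u ω) :=
  StronglyMonotoneLip.measurable_comp (fun ω => h.stronglyMonotoneLip ω i j) (h.measurable i j) hu

lemma memLp_comp_zero [IsFiniteMeasure P] (h : IsGradientOracle m P μ L σ δ g xs) (i : ι)
    (j : ζ) : MemLp (fun ω => g ω i j (xs ω)) 2 P := by
  have : Nonempty ι := ⟨i⟩
  have : Nonempty ζ := ⟨j⟩
  refine .of_bound ((h.measurable_comp h.measurable_zero i j).mono h.le le_rfl).aestronglyMeasurable
    √(Fintype.card ι * (Fintype.card ζ * (σ ^ 2 + δ ^ 2))) ?_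
  filter_upwards [h.ae_avg_avg_norm_sub_sq_le] with ω hω
  refine Real.le_sqrt_of_sq_le ?_
  have hω := hω (xs ω)
  simp only [h.avg_zero, sub_zero] at hω
  calc ‖g ω i j (xs ω)‖ ^ 2 ≤ Fintype.card ζ * avg fun j => ‖g ω i j (xs ω)‖ ^ 2 :=
        le_card_mul_avg (u := fun j => ‖g ω i j (xs ω)‖ ^ 2) (fun j => sq_nonneg _) j
    _ ≤ Fintype.card ζ
          * (Fintype.card ι * avg fun i => avg fun j => ‖g ω i j (xs ω)‖ ^ 2) := by
        gcongr
        exact le_card_mul_avg (u := fun i => avg fun j => ‖g ω i j (xs ω)‖ ^ 2)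
          (fun i => avg_nonneg fun j => sq_nonneg _) i
    _ ≤ Fintype.card ζ * (Fintype.card ι * (σ ^ 2 + δ ^ 2)) := by gcongr
    _ = _ := by ring

lemma memLp_comp [IsFiniteMeasure P] (h : IsGradientOracle m P μ L σ δ g xs)
    (hum : Measurable[m] u) (hu : MemLp u 2 P) (i : ι) (j : ζ) :
    MemLp (fun ω => g ω i j (u ω)) 2 P := by
  have hmeas : ∀ {w : Ω → E}, Measurable[m] w →
      AEStronglyMeasurable (fun ω => g ω i j (w ω)) P := fun hw =>
    ((h.measurable_comp hw i j).mono h.le le_rfl).aestronglyMeasurable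
  have hdiff : MemLp (fun ω => g ω i j (u ω) - g ω i j (xs ω)) 2 P :=
    (hu.sub h.memLp_zero).of_le_mul ((hmeas hum).sub (hmeas h.measurable_zero))
      (.of_forall fun ω => (h.stronglyMonotoneLip ω i j).lip _ _)
  simpa only [Pi.add_def, sub_add_cancel] using hdiff.add (h.memLp_comp_zero i j)

end IsGradientOracle

end GradientOracle

section StochasticStep

variable {ι ζ Ω E : Type*} [Fintype ι] [Fintype ζ] [NormedAddCommGroup E] [InnerProductSpace ℝ E]
  [MeasurableSpace E] [BorelSpace E] [SecondCountableTopology E]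
  [MeasurableSpace ζ] [MeasurableSingletonClass ζ] {m mΩ : MeasurableSpace Ω} {P : Measure Ω}
  [IsProbabilityMeasure P] {μ L σ δ α : ℝ} {g : Ω → ι → ζ → E → E} {xs : Ω → E}
  {X : Ω → ι → E} {J : Ω → ι → ζ}

lemma measurable_avg {_ : MeasurableSpace Ω} (hX : ∀ i, Measurable fun ω => X ω i) :
    Measurable fun ω => avg (X ω) :=
  (Finset.measurable_sum Finset.univ fun i _ => hX i).const_smul (1 / (Fintype.card ι : ℝ))

namespace IsGradientOracle

lemma memLp_noise (h : IsGradientOracle m P μ L σ δ g xs) {u : Ω → E} (hum : Measurable[m] u)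
    (hu : MemLp u 2 P) {i : ι} (hJ : IsUniformDraw m (fun ω => J ω i) P) :
    MemLp (fun ω => g ω i (J ω i) (u ω) - avg fun j => g ω i j (u ω)) 2 P :=
  (hJ.memLp_comp (φ := fun j ω => g ω i j (u ω)) fun j => h.memLp_comp hum hu i j).sub
    (memLp_avg fun j => h.memLp_comp hum hu i j)

lemma integral_norm_noise_sq_le (h : IsGradientOracle m P μ L σ δ g xs) {u : Ω → E}
    (hum : Measurable[m] u) (hu : MemLp u 2 P) {i : ι}
    (hJ : IsUniformDraw m (fun ω => J ω i) P) :
    ∫ ω, ‖g ω i (J ω i) (u ω) - avg fun j => g ω i j (u ω)‖ ^ 2 ∂P ≤ σ ^ 2 :=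
  (hJ.integral_norm_sub_avg_sq (φ := fun j ω => g ω i j (u ω))
    (fun j => (h.measurable_comp hum i j).stronglyMeasurable)
    fun j => h.memLp_comp hum hu i j).trans_le (h.integral_dispersion_le i u)

lemma integral_inner_noise_eq_zero [Nonempty ζ] (h : IsGradientOracle m P μ L σ δ g xs)
    {u v : Ω → E} (hum : Measurable[m] u) (hu : MemLp u 2 P) (hvm : Measurable[m] v)
    (hv : MemLp v 2 P) {i : ι} (hJ : IsUniformDraw m (fun ω => J ω i) P) :
    ∫ ω, inner ℝ (g ω i (J ω i) (u ω) - avg fun j => g ω i j (u ω)) (v ω) ∂P = 0 :=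
  hJ.integral_inner_sub_avg (φ := fun j ω => g ω i j (u ω))
    (fun j => (h.measurable_comp hum i j).stronglyMeasurable)
    (fun j => h.memLp_comp hum hu i j) hvm.stronglyMeasurable hv

lemma integral_avg_norm_noise_sq_le [Nonempty ι] (h : IsGradientOracle m P μ L σ δ g xs)
    {u : ι → Ω → E} (hum : ∀ i, Measurable[m] (u i)) (hu : ∀ i, MemLp (u i) 2 P)
    (hJ : ∀ i, IsUniformDraw m (fun ω => J ω i) P) :
    ∫ ω, avg (fun i => ‖g ω i (J ω i) (u i ω) - avg fun j => g ω i j (u i ω)‖ ^ 2) ∂P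
      ≤ σ ^ 2 := by
  rw [integral_avg fun i => integrable_norm_sq (h.memLp_noise (hum i) (hu i) (hJ i))]
  exact avg_le_of_forall_le fun i => h.integral_norm_noise_sq_le (hum i) (hu i) (hJ i)

variable (h : IsGradientOracle m P μ L σ δ g xs) (hXm : ∀ i, Measurable[m] fun ω => X ω i)
  (hX : ∀ i, MemLp (fun ω => X ω i) 2 P) (hJ : ∀ i, IsUniformDraw m (fun ω => J ω i) P)

include h hXm hX hJ

lemma memLp_gradientStep (α : ℝ) (i : ι) :
    MemLp (fun ω => gradientStep α (fun i => g ω i (J ω i)) (X ω) i) 2 P :=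
  (hX i).sub (((hJ i).memLp_comp (φ := fun j ω => g ω i j (X ω i)) fun j =>
    h.memLp_comp (hXm i) (hX i) i j).const_smul α)

variable [Nonempty ι]

lemma integral_dispersion_gradientStep_le {lam : ℝ} (hlam : 0 < lam)
    (hα : (1 + 16 / lam) * (3 * α ^ 2 * L ^ 2) ≤ lam / 16) :
    ∫ ω, dispersion (gradientStep α (fun i => g ω i (J ω i)) (X ω)) ∂P
      ≤ (1 + lam / 8) * ∫ ω, dispersion (X ω) ∂P
        + 3 * (1 + 16 / lam) * α ^ 2 * (σ ^ 2 + δ ^ 2) := by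
  have hnoise := h.integral_avg_norm_noise_sq_le (u := fun _ ω => avg (X ω))
    (fun _ => measurable_avg hXm) (fun _ => memLp_avg hX) hJ
  set noise : Ω → ℝ := fun ω =>
    avg fun i => ‖g ω i (J ω i) (avg (X ω)) - avg fun j => g ω i j (avg (X ω))‖ ^ 2
  have hnoise_int : Integrable noise P := integrable_avg fun i =>
    integrable_norm_sq (h.memLp_noise (measurable_avg hXm) (memLp_avg hX) (hJ i))
  have hX_int : Integrable (fun ω => (1 + lam / 8) * dispersion (X ω)) P :=
    (integrable_dispersion hX).const_mul (1 + lam / 8)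
  have herr_int : Integrable (fun ω => 3 * (1 + 16 / lam) * α ^ 2 * (noise ω + δ ^ 2)) P :=
    (hnoise_int.add (integrable_const (δ ^ 2))).const_mul (3 * (1 + 16 / lam) * α ^ 2)
  calc _ ≤ ∫ ω, ((1 + lam / 8) * dispersion (X ω)
        + 3 * (1 + 16 / lam) * α ^ 2 * (noise ω + δ ^ 2)) ∂P := by
        refine integral_mono_ae (integrable_dispersion (h.memLp_gradientStep hXm hX hJ α))
          (hX_int.add herr_int) ?_
        filter_upwards [h.heterogeneity] with ω hδ
        refine (dispersion_gradientStep_le (fun i => (h.stronglyMonotoneLip ω i _).lip) hlam hα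
          (X ω) fun i => avg fun j => g ω i j (avg (X ω))).trans ?_
        gcongr
        exact hδ _
    _ = (1 + lam / 8) * ∫ ω, dispersion (X ω) ∂P
        + 3 * (1 + 16 / lam) * α ^ 2 * (∫ ω, noise ω ∂P + δ ^ 2) := by
        rw [integral_add hX_int herr_int, integral_const_mul, integral_const_mul,
          integral_add hnoise_int (integrable_const _), integral_const, probReal_univ, one_smul]
    _ ≤ _ := by gcongr

variable [Nonempty ζ]

lemma integral_norm_avg_gradientStep_sub_sq_le (hα : 0 ≤ α) (hαL : α * L ^ 2 ≤ μ) {τ : ℝ}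
    (hτ : 0 < τ) :
    ∫ ω, ‖avg (gradientStep α (fun i => g ω i (J ω i)) (X ω)) - xs ω‖ ^ 2 ∂P
      ≤ (1 + τ) * ((1 - α * μ) * ∫ ω, ‖avg (X ω) - xs ω‖ ^ 2 ∂P)
        + (1 + 1 / τ) * (α ^ 2 * (L ^ 2 * ∫ ω, dispersion (X ω) ∂P)) + α ^ 2 * σ ^ 2 := by
  set drift : Ω → E := fun ω =>
    avg (gradientStep α (fun i x => avg fun j => g ω i j x) (X ω)) - xs ω
  set noise : Ω → E := fun ω =>
    avg fun i => g ω i (J ω i) (X ω i) - avg fun j => g ω i j (X ω i)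
  have hdrift : MemLp drift 2 P :=
    (memLp_avg fun i => (hX i).sub ((memLp_avg fun j =>
      h.memLp_comp (hXm i) (hX i) i j).const_smul α)).sub h.memLp_zero
  have hdrift_meas : Measurable[m] drift :=
    (measurable_avg (X := fun ω => gradientStep α (fun i x => avg fun j => g ω i j x) (X ω))
      fun i => (hXm i).sub ((measurable_avg (X := fun ω j => g ω i j (X ω i))
        fun j => h.measurable_comp (hXm i) i j).const_smul α)).sub h.measurable_zero
  have hnoise_i := fun i => h.memLp_noise (hXm i) (hX i) (hJ i)
  have hnoise : MemLp noise 2 P := memLp_avg hnoise_i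
  have horth : ∫ ω, inner ℝ (noise ω) (drift ω) ∂P = 0 := by
    simp only [noise, inner_avg_left]
    rw [integral_avg fun i => integrable_inner (hnoise_i i) hdrift]
    simp only [h.integral_inner_noise_eq_zero (hXm _) (hX _) hdrift_meas hdrift (hJ _), avg_const]
  have hvar : ∫ ω, ‖noise ω‖ ^ 2 ∂P ≤ σ ^ 2 :=
    (integral_mono (integrable_norm_sq hnoise)
      (integrable_avg fun i => integrable_norm_sq (hnoise_i i)) fun ω => norm_avg_sq_le _).trans
      (h.integral_avg_norm_noise_sq_le hXm hX hJ)
  have hsplit : ∀ ω, avg (gradientStep α (fun i => g ω i (J ω i)) (X ω)) - xs ω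
      = drift ω - α • noise ω := fun ω => by
    simp only [drift, noise, avg_gradientStep, avg_sub]; module
  simp only [hsplit, integral_norm_sub_smul_sq hdrift hnoise horth α]
  gcongr
  exact h.integral_norm_avg_meanStep_sub_sq_le hX hα hαL hτ hdrift

end IsGradientOracle

end StochasticStep

section ScalarRecursions

lemma le_div_sq_of_recursion {u : ℕ → ℝ} {lam D k₁ : ℝ} (hlam : 0 < lam) (hlam1 : lam ≤ 1)
    (hD : 0 ≤ D) (hk₁ : 32 / lam ≤ k₁) (hu0 : u 0 ≤ 0) (hu : ∀ k, 0 ≤ u k)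
    (hrec : ∀ k : ℕ, u (k + 1) ≤ (1 - lam / 4) * ((1 + lam / 8) * u k + D / (k + k₁) ^ 2))
    (k : ℕ) : u k ≤ 16 * D / lam / (k + k₁) ^ 2 := by
  have hk₁_pos : 0 < k₁ := lt_of_lt_of_le (by positivity) hk₁
  rw [div_le_iff₀ hlam] at hk₁
  induction k with
  | zero => exact hu0.trans (by positivity)
  | succ k ih =>
    have hm : 0 < (k : ℝ) + k₁ := by positivity
    have hle_m : k₁ ≤ k + k₁ := by simp
    rw [Nat.cast_succ, add_right_comm]
    set m := (k : ℝ) + k₁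
    have hm_lam : 32 ≤ m * lam := hk₁.trans (by gcongr)
    have hDm : 0 ≤ D / m ^ 2 := by positivity
    calc u (k + 1) ≤ (1 - lam / 8) * u k + D / m ^ 2 := by
          nlinarith [hrec k, mul_nonneg (sq_nonneg lam) (hu k), mul_nonneg hlam.le hDm]
      _ ≤ (1 - lam / 8) * (16 * D / lam / m ^ 2) + D / m ^ 2 := by gcongr; linarith
      _ = 16 * D / lam * ((1 - lam / 16) / m ^ 2) := by field_simp; ring
      _ ≤ 16 * D / lam * (1 / (m + 1) ^ 2) := by
          gcongr 16 * D / lam * ?_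
          rw [div_le_div_iff₀ (by positivity) (by positivity)]
          nlinarith [mul_le_mul_of_nonneg_right hm_lam hm.le]
      _ = 16 * D / lam / (m + 1) ^ 2 := by ring

lemma le_div_add_of_recursion {r : ℕ → ℝ} {a b k₁ : ℝ} (ha : 0 ≤ a) (hb : 0 ≤ b) (hk₁ : 2 ≤ k₁)
    (hr0 : 0 ≤ r 0)
    (hrec : ∀ k : ℕ,
      r (k + 1) ≤ (1 - 3 / 2 / (k + k₁)) * r k + a / (k + k₁) ^ 2 + b / (k + k₁))
    (k : ℕ) : r k ≤ (k₁ * r 0 + 2 * a) / (k + k₁) + b := by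
  induction k with
  | zero =>
    have hk₁_pos : 0 < k₁ := by linarith
    have : r 0 ≤ (k₁ * r 0 + 2 * a) / k₁ := by rw [le_div_iff₀ hk₁_pos]; linarith
    simp only [Nat.cast_zero, zero_add]
    linarith
  | succ k ih =>
    have hm : 2 ≤ (k : ℝ) + k₁ := by linarith [Nat.cast_nonneg (α := ℝ) k]
    have hrec := hrec k
    rw [Nat.cast_succ, add_right_comm]
    set m := (k : ℝ) + k₁
    have hr0' : 0 ≤ k₁ * r 0 := by positivity
    set q := k₁ * r 0 + 2 * a
    have hcoef : 0 ≤ 1 - 3 / 2 / m := by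
      rw [sub_nonneg, div_le_one (by linarith)]; linarith
    have hgap : q / (m + 1) + b - ((1 - 3 / 2 / m) * (q / m + b) + a / m ^ 2 + b / m)
        = ((q - 2 * a) * (m + 1) + 2 * q) / (2 * m ^ 2 * (m + 1)) + b / (2 * m) := by
      field_simp; ring
    have hgap_nonneg :
        0 ≤ ((q - 2 * a) * (m + 1) + 2 * q) / (2 * m ^ 2 * (m + 1)) + b / (2 * m) := by
      have : 0 ≤ q - 2 * a := by linarith
      have : 0 ≤ q := by linarith
      positivity
    linarith [mul_le_mul_of_nonneg_left ih hcoef]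

lemma round_bound_le {μ L m r D D' c c' κ s V : ℝ} (hμ : 0 < μ) (hm : 2 ≤ m) (hr : 0 ≤ r)
    (hD : 0 ≤ D) (hD' : 0 ≤ D') (hκ : 0 ≤ κ) (hDle : D ≤ c * V / m ^ 2)
    (hDle' : D' ≤ c' * V / m ^ 2) (hs : 0 ≤ s) (hsV : s ≤ V) :
    (1 + 1 / (8 * m)) * ((1 + 1 / (8 * m)) * ((1 - 2 / (μ * m) * μ) * r)
        + (1 + 1 / (1 / (8 * m))) * ((2 / (μ * m)) ^ 2 * (L ^ 2 * D)) + (2 / (μ * m)) ^ 2 * s)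
        + (1 + 1 / (1 / (8 * m))) * (κ * D')
      ≤ (1 - 3 / 2 / m) * r + (72 * L ^ 2 * c / μ ^ 2 + 8 / μ ^ 2) * V / m ^ 2
        + 9 * c' * (κ * V) / m := by
  have hτ : 1 + 1 / (8 * m) ≤ 2 := by
    have : 1 / (8 * m) ≤ 1 := by rw [div_le_one (by positivity)]; linarith
    linarith
  have hτ_inv : 1 + 1 / (1 / (8 * m)) ≤ 9 * m := by rw [one_div_one_div]; linarith
  have hDc := hD.trans hDle
  have hcontr : (1 + 1 / (8 * m)) * ((1 + 1 / (8 * m)) * (1 - 2 / (μ * m) * μ))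
      ≤ 1 - 3 / 2 / m := by
    rw [← sub_nonneg]
    calc (0 : ℝ) ≤ (16 * m ^ 2 + 31 * m + 2) / (64 * m ^ 3) := by positivity
      _ = _ := by field_simp; ring
  calc _ = (1 + 1 / (8 * m)) * ((1 + 1 / (8 * m)) * (1 - 2 / (μ * m) * μ)) * r
        + (1 + 1 / (8 * m)) * ((1 + 1 / (1 / (8 * m))) * ((2 / (μ * m)) ^ 2 * (L ^ 2 * D)))
        + (1 + 1 / (8 * m)) * ((2 / (μ * m)) ^ 2 * s) + (1 + 1 / (1 / (8 * m))) * (κ * D') := by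
        ring
    _ ≤ (1 - 3 / 2 / m) * r + 2 * (9 * m * ((2 / (μ * m)) ^ 2 * (L ^ 2 * (c * V / m ^ 2))))
        + 2 * ((2 / (μ * m)) ^ 2 * V) + 9 * m * (κ * (c' * V / m ^ 2)) := by gcongr
    _ = (1 - 3 / 2 / m) * r + 72 * L ^ 2 / μ ^ 2 * (c * V / m ^ 2) / m
        + 8 / μ ^ 2 * V / m ^ 2 + 9 * c' * (κ * V) / m := by field_simp; ring
    _ ≤ (1 - 3 / 2 / m) * r + 72 * L ^ 2 / μ ^ 2 * (c * V / m ^ 2)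
        + 8 / μ ^ 2 * V / m ^ 2 + 9 * c' * (κ * V) / m := by
        gcongr
        exact div_le_self (by positivity) (by linarith)
    _ = _ := by ring

end ScalarRecursions

section Rates

/-- The shift `k₁` from which on the rates for the step sizes `2 / (μ (k + k₁))` are valid. -/
noncomputable def shiftThreshold (μ L lam : ℝ) : ℝ :=
  2 + 32 / lam + 2 * L ^ 2 / μ ^ 2 + (1 + 16 / lam) * (192 * L ^ 2 / (μ ^ 2 * lam))

/-- The gradient noise and heterogeneity `σ² + δ²` enter the dispersion after a gradient step with
step size `2 / (μ m)` with the factor `roundConst μ lam / m²`. -/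
noncomputable def roundConst (μ lam : ℝ) : ℝ :=
  12 * (1 + 16 / lam) / μ ^ 2

/-- The constant in the `O(1 / k²)` bound on the dispersion. -/
noncomputable def dispersionConst (μ lam : ℝ) : ℝ :=
  16 * roundConst μ lam / lam

/-- The constant in the convergence rate of the average model. -/
noncomputable def rateConst (μ L lam : ℝ) : ℝ :=
  2 * (72 * L ^ 2 * dispersionConst μ lam / μ ^ 2 + 8 / μ ^ 2)
    + 9 * (2 * dispersionConst μ lam + roundConst μ lam)

variable {μ L lam k₁ : ℝ}

lemma roundConst_pos (hμ : 0 < μ) (hlam : 0 < lam) : 0 < roundConst μ lam := by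
  unfold roundConst; positivity

lemma dispersionConst_pos (hμ : 0 < μ) (hlam : 0 < lam) : 0 < dispersionConst μ lam := by
  have := roundConst_pos hμ hlam
  unfold dispersionConst; positivity

lemma rateConst_pos (hμ : 0 < μ) (hlam : 0 < lam) : 0 < rateConst μ L lam := by
  have := roundConst_pos hμ hlam
  have := dispersionConst_pos hμ hlam
  unfold rateConst; positivity

lemma two_le_of_shiftThreshold_le (hlam : 0 < lam) {m : ℝ} (hm : shiftThreshold μ L lam ≤ m) :
    2 ≤ m := by
  refine le_trans ?_ hm
  simp only [shiftThreshold, add_assoc]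
  exact le_add_of_nonneg_right (by positivity)

lemma div_le_of_shiftThreshold_le (hlam : 0 < lam) {m : ℝ} (hm : shiftThreshold μ L lam ≤ m) :
    32 / lam ≤ m := by
  refine le_trans ?_ hm
  rw [shiftThreshold, add_assoc, add_assoc, add_left_comm]
  exact le_add_of_nonneg_right (by positivity)

lemma stepSize_mul_sq_le (hμ : 0 < μ) (hlam : 0 < lam) {m : ℝ}
    (hm : shiftThreshold μ L lam ≤ m) : 2 / (μ * m) * L ^ 2 ≤ μ := by
  have hm2 := two_le_of_shiftThreshold_le hlam hm
  have : 2 * L ^ 2 / μ ^ 2 ≤ m := by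
    refine le_trans ?_ hm
    rw [shiftThreshold, add_right_comm]
    exact le_add_of_nonneg_left (by positivity)
  rw [div_le_iff₀ (by positivity)] at this
  rw [div_mul_eq_mul_div, div_le_iff₀ (by positivity)]
  linarith

lemma mul_stepSize_sq_le (hμ : 0 < μ) (hlam : 0 < lam) {m : ℝ}
    (hm : shiftThreshold μ L lam ≤ m) :
    (1 + 16 / lam) * (3 * (2 / (μ * m)) ^ 2 * L ^ 2) ≤ lam / 16 := by
  have hm2 := two_le_of_shiftThreshold_le hlam hm
  have : (1 + 16 / lam) * (192 * L ^ 2 / (μ ^ 2 * lam)) ≤ m ^ 2 := by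
    refine le_trans ?_ (hm.trans (le_self_pow₀ (by linarith) two_ne_zero))
    exact le_add_of_nonneg_left (by positivity)
  calc (1 + 16 / lam) * (3 * (2 / (μ * m)) ^ 2 * L ^ 2)
      = (1 + 16 / lam) * (192 * L ^ 2 / (μ ^ 2 * lam)) * (lam / 16 / m ^ 2) := by
        field_simp; ring
    _ ≤ m ^ 2 * (lam / 16 / m ^ 2) := by gcongr
    _ = lam / 16 := by field_simp

end Rates

/-- A decentralized stochastic gradient method: at time `k` every agent `i` makes the gradient step
of size `α k` along the oracle answer with the random number `J k ω i`; the communication that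
follows contracts the dispersion by the factor `1 - lam / 4` and moves the squared average by at
most `κ` times the dispersion. -/
structure IsConsensusSGD {ι ζ Ω E : Type*} [Fintype ι] [Fintype ζ] [MeasurableSpace ζ]
    [NormedAddCommGroup E] [InnerProductSpace ℝ E] [MeasurableSpace E] {mΩ : MeasurableSpace Ω}
    (P : Measure Ω) (𝓕 : Filtration ℕ mΩ) (g : Ω → ι → ζ → E → E) (α : ℕ → ℝ) (lam κ : ℝ)
    (J : ℕ → Ω → ι → ζ) (x : ℕ → Ω → ι → E) : Prop where
  measurable : ∀ k i, Measurable[𝓕 k] fun ω => x k ω i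
  memLp : ∀ k i, MemLp (fun ω => x k ω i) 2 P
  isUniformDraw : ∀ k i, IsUniformDraw (𝓕 k) (fun ω => J k ω i) P
  dispersion_zero : ∀ ω, dispersion (x 0 ω) = 0
  dispersion_succ_le : ∀ k ω, dispersion (x (k + 1) ω)
    ≤ (1 - lam / 4) * dispersion (gradientStep (α k) (fun i => g ω i (J k ω i)) (x k ω))
  norm_avg_succ_sub_sq_le : ∀ k ω,
    ‖avg (x (k + 1) ω) - avg (gradientStep (α k) (fun i => g ω i (J k ω i)) (x k ω))‖ ^ 2
      ≤ κ * dispersion (gradientStep (α k) (fun i => g ω i (J k ω i)) (x k ω))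

namespace IsConsensusSGD

variable {ι ζ Ω E : Type*} [Fintype ι] [Fintype ζ] [MeasurableSpace ζ] [MeasurableSingletonClass ζ]
  [NormedAddCommGroup E] [InnerProductSpace ℝ E] [MeasurableSpace E] [BorelSpace E]
  [SecondCountableTopology E] {mΩ : MeasurableSpace Ω} {P : Measure Ω} [IsProbabilityMeasure P]
  {𝓕 : Filtration ℕ mΩ} {g : Ω → ι → ζ → E → E} {α : ℕ → ℝ} {μ L σ δ lam κ k₁ : ℝ}
  {J : ℕ → Ω → ι → ζ} {x : ℕ → Ω → ι → E} {xs : Ω → E}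

lemma memLp_gradientStep (h : IsConsensusSGD P 𝓕 g α lam κ J x)
    (hg : IsGradientOracle (𝓕 0) P μ L σ δ g xs) (k : ℕ) (i : ι) :
    MemLp (fun ω => gradientStep (α k) (fun i => g ω i (J k ω i)) (x k ω) i) 2 P :=
  (hg.mono (𝓕.mono k.zero_le) (𝓕.le k)).memLp_gradientStep (h.measurable k) (h.memLp k)
    (h.isUniformDraw k) (α k) i

lemma integral_dispersion_succ_le (h : IsConsensusSGD P 𝓕 g α lam κ J x)
    (hg : IsGradientOracle (𝓕 0) P μ L σ δ g xs) (k : ℕ) :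
    ∫ ω, dispersion (x (k + 1) ω) ∂P ≤ (1 - lam / 4)
      * ∫ ω, dispersion (gradientStep (α k) (fun i => g ω i (J k ω i)) (x k ω)) ∂P := by
  rw [← integral_const_mul]
  exact integral_mono (integrable_dispersion (h.memLp _))
    ((integrable_dispersion (h.memLp_gradientStep hg k)).const_mul _) (h.dispersion_succ_le k)

variable [Nonempty ι]

lemma integral_norm_avg_succ_sub_sq_le [Nonempty ζ] (h : IsConsensusSGD P 𝓕 g α lam κ J x)
    (hg : IsGradientOracle (𝓕 0) P μ L σ δ g xs) {k : ℕ} (hα : 0 ≤ α k) (hαL : α k * L ^ 2 ≤ μ)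
    {τ : ℝ} (hτ : 0 < τ) :
    ∫ ω, ‖avg (x (k + 1) ω) - xs ω‖ ^ 2 ∂P
      ≤ (1 + τ) * ((1 + τ) * ((1 - α k * μ) * ∫ ω, ‖avg (x k ω) - xs ω‖ ^ 2 ∂P)
          + (1 + 1 / τ) * (α k ^ 2 * (L ^ 2 * ∫ ω, dispersion (x k ω) ∂P)) + α k ^ 2 * σ ^ 2)
        + (1 + 1 / τ) * (κ
          * ∫ ω, dispersion (gradientStep (α k) (fun i => g ω i (J k ω i)) (x k ω)) ∂P) := by
  have hgk := hg.mono (𝓕.mono k.zero_le) (𝓕.le k)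
  have hstep := hgk.integral_norm_avg_gradientStep_sub_sq_le (h.measurable k) (h.memLp k)
    (h.isUniformDraw k) hα hαL hτ
  set y : Ω → ι → E := fun ω => gradientStep (α k) (fun i => g ω i (J k ω i)) (x k ω)
  have hy := h.memLp_gradientStep hg k
  have hdist_int : Integrable (fun ω => (1 + τ) * ‖avg (y ω) - xs ω‖ ^ 2) P :=
    (integrable_norm_sq ((memLp_avg hy).sub hg.memLp_zero)).const_mul _
  have hdisp_int : Integrable (fun ω => (1 + 1 / τ) * (κ * dispersion (y ω))) P :=
    ((integrable_dispersion hy).const_mul _).const_mul _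
  calc _ ≤ ∫ ω, ((1 + τ) * ‖avg (y ω) - xs ω‖ ^ 2 + (1 + 1 / τ) * (κ * dispersion (y ω))) ∂P := by
        refine integral_mono
          (integrable_norm_sq ((memLp_avg (h.memLp (k + 1))).sub hg.memLp_zero))
          (hdist_int.add hdisp_int) fun ω => ?_
        rw [← sub_add_sub_cancel' (avg (y ω))]
        refine (norm_add_sq_le_young _ _ hτ).trans ?_
        gcongr
        exact h.norm_avg_succ_sub_sq_le k ω
    _ = (1 + τ) * ∫ ω, ‖avg (y ω) - xs ω‖ ^ 2 ∂P
        + (1 + 1 / τ) * (κ * ∫ ω, dispersion (y ω) ∂P) := by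
        rw [integral_add hdist_int hdisp_int, integral_const_mul, integral_const_mul,
          integral_const_mul]
    _ ≤ _ := by gcongr

section DecreasingStepSizes

variable (h : IsConsensusSGD P 𝓕 g (fun k => 2 / (μ * (k + k₁))) lam κ J x)
  (hg : IsGradientOracle (𝓕 0) P μ L σ δ g xs) (hμ : 0 < μ) (hlam : 0 < lam)
  (hk₁ : shiftThreshold μ L lam ≤ k₁)

include h hg hμ hlam hk₁

lemma integral_dispersion_gradientStep_le (k : ℕ) :
    ∫ ω, dispersion (gradientStep (2 / (μ * (k + k₁))) (fun i => g ω i (J k ω i)) (x k ω)) ∂P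
      ≤ (1 + lam / 8) * ∫ ω, dispersion (x k ω) ∂P
        + roundConst μ lam * (σ ^ 2 + δ ^ 2) / (k + k₁) ^ 2 := by
  have hm : shiftThreshold μ L lam ≤ k + k₁ := hk₁.trans (by simp)
  have hm2 := two_le_of_shiftThreshold_le hlam hm
  refine ((hg.mono (𝓕.mono k.zero_le) (𝓕.le k)).integral_dispersion_gradientStep_le
    (h.measurable k) (h.memLp k) (h.isUniformDraw k) hlam
    (mul_stepSize_sq_le hμ hlam hm)).trans_eq ?_
  unfold roundConst
  field_simp
  ring

variable (hlam1 : lam ≤ 1)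

include hlam1

lemma integral_dispersion_le (k : ℕ) :
    ∫ ω, dispersion (x k ω) ∂P ≤ dispersionConst μ lam * (σ ^ 2 + δ ^ 2) / (k + k₁) ^ 2 := by
  have hconst := roundConst_pos hμ hlam
  refine (le_div_sq_of_recursion (D := roundConst μ lam * (σ ^ 2 + δ ^ 2)) hlam hlam1
    (by positivity) (div_le_of_shiftThreshold_le hlam hk₁) (by simp [h.dispersion_zero])
    (fun j => integral_nonneg fun ω => dispersion_nonneg _) (fun j => ?_) k).trans_eq ?_
  · refine (h.integral_dispersion_succ_le hg j).trans ?_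
    gcongr
    · linarith
    · exact h.integral_dispersion_gradientStep_le hg hμ hlam hk₁ j
  · unfold dispersionConst; ring

lemma integral_dispersion_gradientStep_le_div (k : ℕ) :
    ∫ ω, dispersion (gradientStep (2 / (μ * (k + k₁))) (fun i => g ω i (J k ω i)) (x k ω)) ∂P
      ≤ (2 * dispersionConst μ lam + roundConst μ lam) * (σ ^ 2 + δ ^ 2) / (k + k₁) ^ 2 := by
  have hdisp : 0 ≤ ∫ ω, dispersion (x k ω) ∂P := integral_nonneg fun ω => dispersion_nonneg _
  calc _ ≤ (1 + lam / 8) * ∫ ω, dispersion (x k ω) ∂P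
        + roundConst μ lam * (σ ^ 2 + δ ^ 2) / (k + k₁) ^ 2 :=
        h.integral_dispersion_gradientStep_le hg hμ hlam hk₁ k
    _ ≤ 2 * (dispersionConst μ lam * (σ ^ 2 + δ ^ 2) / (k + k₁) ^ 2)
        + roundConst μ lam * (σ ^ 2 + δ ^ 2) / (k + k₁) ^ 2 := by
        gcongr
        · linarith
        · exact h.integral_dispersion_le hg hμ hlam hk₁ hlam1 k
    _ = _ := by ring

theorem integral_norm_avg_sub_sq_le [Nonempty ζ] (hκ : 0 ≤ κ) (k : ℕ) :
    ∫ ω, ‖avg (x k ω) - xs ω‖ ^ 2 ∂P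
      ≤ (k₁ * ∫ ω, ‖avg (x 0 ω) - xs ω‖ ^ 2 ∂P + rateConst μ L lam * (σ ^ 2 + δ ^ 2)) / (k + k₁)
        + rateConst μ L lam * (κ * (σ ^ 2 + δ ^ 2)) := by
  have hround := roundConst_pos hμ hlam
  have hdisp := dispersionConst_pos hμ hlam
  have hm : ∀ j : ℕ, shiftThreshold μ L lam ≤ j + k₁ := fun j => hk₁.trans (by simp)
  have hm2 := fun j => two_le_of_shiftThreshold_le hlam (hm j)
  refine (le_div_add_of_recursion
    (r := fun j => ∫ ω, ‖avg (x j ω) - xs ω‖ ^ 2 ∂P)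
    (a := (72 * L ^ 2 * dispersionConst μ lam / μ ^ 2 + 8 / μ ^ 2) * (σ ^ 2 + δ ^ 2))
    (b := 9 * (2 * dispersionConst μ lam + roundConst μ lam) * (κ * (σ ^ 2 + δ ^ 2)))
    (by positivity) (by positivity) (two_le_of_shiftThreshold_le hlam hk₁)
    (integral_nonneg fun ω => by positivity) (fun j => ?_) k).trans ?_
  · have := hm2 j
    exact (h.integral_norm_avg_succ_sub_sq_le hg (by positivity)
      (stepSize_mul_sq_le hμ hlam (hm j)) (τ := 1 / (8 * (j + k₁))) (by positivity)).trans
      (round_bound_le hμ (hm2 j) (integral_nonneg fun ω => by positivity)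
        (integral_nonneg fun ω => dispersion_nonneg _)
        (integral_nonneg fun ω => dispersion_nonneg _) hκ
        (h.integral_dispersion_le hg hμ hlam hk₁ hlam1 j)
        (h.integral_dispersion_gradientStep_le_div hg hμ hlam hk₁ hlam1 j) (sq_nonneg σ)
        (le_add_of_nonneg_right (sq_nonneg δ)))
  · have := hm2 k
    rw [← mul_assoc 2]
    gcongr
    · exact le_add_of_nonneg_right (by positivity)
    · exact le_add_of_nonneg_left (by positivity)

end DecreasingStepSizes

end IsConsensusSGD

section DsgdProcess

lemma measurable_of_hasGradientAt {Ξ E : Type*} [MeasurableSpace Ξ] [NormedAddCommGroup E]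
    [InnerProductSpace ℝ E] [FiniteDimensional ℝ E] [MeasurableSpace E] [BorelSpace E]
    {F : E → Ξ → ℝ} {F' : Ξ → E} {x : E} (hF : ∀ ξ, HasGradientAt (fun y => F y ξ) (F' ξ) x)
    (hm : ∀ y, Measurable (F y)) : Measurable F' := by
  have hinner : ∀ v, Measurable fun ξ => inner ℝ (F' ξ) v := fun v => by
    refine measurable_of_tendsto_metrizable
      (f := fun (n : ℕ) ξ => (n : ℝ) • (F (x + (n : ℝ)⁻¹ • v) ξ - F x ξ))
      (fun n => ((hm _).sub (hm _)).const_smul (n : ℝ)) (tendsto_pi_nhds.2 fun ξ => ?_)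
    simpa using (hasGradientAt_iff_hasFDerivAt.1 (hF ξ)).lim v
      (c := fun n : ℕ => (n : ℝ)) (l := Filter.atTop)
      (by simpa using tendsto_natCast_atTop_atTop (R := ℝ))
  let b := stdOrthonormalBasis ℝ E
  have hrepr : F' = fun ξ => ∑ i, inner ℝ (F' ξ) (b i) • b i := funext fun ξ => by
    simpa only [real_inner_comm] using (b.sum_repr' (F' ξ)).symm
  rw [hrepr]
  exact Finset.measurable_sum _ fun i _ => (hinner _).smul_const _

variable {N B Z d : ℕ} {Ξ Ω : Type*} [MeasurableSpace Ξ] {mΩ : MeasurableSpace Ω} {P : Measure Ω}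
  {𝓕 : Filtration ℕ mΩ} {D : Fin N → Measure Ξ} {S : Ω → Fin N → Fin Z → Ξ}
  {idx : ℕ → Ω → Fin N → Fin Z} {byz : ℕ → Fin B → Fin N → Ω → Model d} {f : Model d → Ξ → ℝ}
  {μ L lam ρ σ δ : ℝ} {α : ℕ → ℝ} {x₀ : Model d} {xs : Ω → Model d}
  {G : SimpleGraph (Fin N ⊕ Fin B)} {A : (n : Fin N) → AggregationRule G d n}
  {W : Matrix (Fin N) (Fin N) ℝ}

lemma StronglyConvexLoss.measurable_lossGrad (hf : StronglyConvexLoss f μ)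
    (hm : ∀ x, Measurable (f x)) (x : Model d) : Measurable fun ξ => lossGrad f ξ x :=
  measurable_of_hasGradientAt (fun ξ => ((hf ξ).1 x).hasGradientAt) hm

lemma IsByzantineSetup.isGradientOracle (h : IsByzantineSetup P 𝓕 D S idx byz)
    (hf : StronglyConvexLoss f μ) (hs : SmoothLoss f L) (hm : ∀ x, Measurable (f x))
    (hσ : ∀ᵐ ω ∂P, BoundedNoise f (S ω) σ) (hδ : ∀ᵐ ω ∂P, BoundedHeterogeneity f (S ω) δ)
    (hxs : Measurable[𝓕 0] xs) (hzero : ∀ ω, empiricalGrad f (S ω) (xs ω) = 0)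
    (hxs2 : MemLp xs 2 P) :
    IsGradientOracle (𝓕 0) P μ L σ δ (fun ω n z => lossGrad f (S ω n z)) xs where
  le := 𝓕.le 0
  stronglyMonotoneLip ω n z := hf.stronglyMonotoneLip_lossGrad hs (S ω n z)
  measurable n z x := (hf.measurable_lossGrad hm x).comp (h.data_meas n z)
  noise := hσ.mono fun _ hω x n => hω.avg_norm_lossGrad_sub_localGrad_sq_le hf x n
  heterogeneity := hδ.mono fun _ hω x => hω.avg_norm_localGrad_sub_sq_le hf x
  measurable_zero := hxs
  avg_zero := hzero
  memLp_zero := hxs2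

lemma IsByzantineSetup.measurable_halfStep (h : IsByzantineSetup P 𝓕 D S idx byz)
    (hg : IsGradientOracle (𝓕 0) P μ L σ δ (fun ω n z => lossGrad f (S ω n z)) xs) {k : ℕ}
    {X : Ω → Fin N → Model d} (hX : ∀ n, Measurable[𝓕 k] fun ω => X ω n) (n : Fin N) :
    Measurable[𝓕 (k + 1)] fun ω => halfStep f (S ω) (α k) (idx k ω) (X ω) n := by
  have hX' := (hX n).mono (𝓕.mono k.le_succ) le_rfl
  have hdraw : Measurable[𝓕 (k + 1)] fun ω => lossGrad f (S ω n (idx k ω n)) (X ω n) := by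
    rw [sum_indicator_preimage_singleton (φ := fun z ω => lossGrad f (S ω n z) (X ω n))]
    refine Finset.measurable_sum _ fun z _ => Measurable.indicator ?_
      ((measurable_pi_apply n).comp (h.idx_meas k) (measurableSet_singleton z))
    exact (hg.mono (𝓕.mono (k + 1).zero_le) (𝓕.le _)).measurable_comp hX' n z
  exact hX'.sub (hdraw.const_smul (α k))

lemma IsByzantineSetup.measurable_dsgd (h : IsByzantineSetup P 𝓕 D S idx byz)
    (hg : IsGradientOracle (𝓕 0) P μ L σ δ (fun ω n z => lossGrad f (S ω n z)) xs)
    (hA : ∀ n, Measurable fun p : Model d × (G.neighborSet (Sum.inl n) → Model d) => A n p.1 p.2)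
    (k : ℕ) (n : Fin N) : Measurable[𝓕 k] fun ω => dsgd f G A α x₀ S idx byz k ω n := by
  induction k generalizing n with
  | zero => exact measurable_const
  | succ k ih =>
    refine (hA n).comp ((h.measurable_halfStep hg ih n).prodMk ?_)
    refine @measurable_pi_lambda _ _ _ (𝓕 (k + 1)) _ _ fun m => ?_
    rcases m with ⟨m | b, _⟩
    · exact h.measurable_halfStep hg ih m
    · exact h.byz_meas k b n

lemma IsByzantineSetup.memLp_dsgd [IsProbabilityMeasure P] (h : IsByzantineSetup P 𝓕 D S idx byz)
    (hg : IsGradientOracle (𝓕 0) P μ L σ δ (fun ω n z => lossGrad f (S ω n z)) xs)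
    (hA : ∀ n, Measurable fun p : Model d × (G.neighborSet (Sum.inl n) → Model d) => A n p.1 p.2)
    (hW : IsVirtualMixing G A W ρ) (k : ℕ) (n : Fin N) :
    MemLp (fun ω => dsgd f G A α x₀ S idx byz k ω n) 2 P := by
  induction k generalizing n with
  | zero => exact memLp_const x₀
  | succ k ih =>
    have hhalf := (hg.mono (𝓕.mono k.zero_le) (𝓕.le k)).memLp_gradientStep
      (fun i => h.measurable_dsgd hg hA k i) ih (h.isUniformDraw k) (α k)
    refine ((memLp_finsetSum Finset.univ fun m _ => (hhalf m).norm).const_mul (2 * ρ + 1)).mono'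
      ((h.measurable_dsgd hg hA (k + 1) n).mono (𝓕.le _) le_rfl).aestronglyMeasurable
      (.of_forall fun ω => ?_)
    exact hW.norm_aggregate_le _ _ n

lemma IsByzantineSetup.isConsensusSGD [NeZero N] [IsProbabilityMeasure P]
    (h : IsByzantineSetup P 𝓕 D S idx byz)
    (hg : IsGradientOracle (𝓕 0) P μ L σ δ (fun ω n z => lossGrad f (S ω n z)) xs)
    (hA : ∀ n, Measurable fun p : Model d × (G.neighborSet (Sum.inl n) → Model d) => A n p.1 p.2)
    (hW : IsVirtualMixing G A W ρ) (hlam : 0 < lam) (hgap : mixingGap W = lam)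
    (hρ : ρ < lam / (8 * √(N : ℝ))) :
    IsConsensusSGD P 𝓕 (fun ω n z => lossGrad f (S ω n z)) α lam (2 * (4 * ρ ^ 2 * N + chiSq W)) idx
      (dsgd f G A α x₀ S idx byz) where
  measurable := h.measurable_dsgd hg hA
  memLp := h.memLp_dsgd hg hA hW
  isUniformDraw := h.isUniformDraw
  dispersion_zero _ := dispersion_const x₀
  dispersion_succ_le k ω := hW.dispersion_aggregate_le _ (fun n b => byz k b n ω) hlam hgap hρ
  norm_avg_succ_sub_sq_le k ω :=
    hW.norm_avg_aggregate_sub_avg_sq_le _ fun n b => byz k b n ω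

end DsgdProcess

section IndependentAverage

variable {Ω E : Type*} {mΩ : MeasurableSpace Ω} {P : Measure Ω} [NormedAddCommGroup E]
  [InnerProductSpace ℝ E] [CompleteSpace E] [MeasurableSpace E] [BorelSpace E]

lemma integral_inner_of_indepFun {X Y : Ω → E} (hXY : IndepFun X Y P) (hX : Integrable X P)
    (hY : Integrable Y P) :
    ∫ ω, inner ℝ (X ω) (Y ω) ∂P = inner ℝ (∫ ω, X ω ∂P) (∫ ω, Y ω ∂P) :=
  hXY.integral_bilin hX hY (innerSL ℝ)

variable [IsProbabilityMeasure P] {ι : Type*} [Fintype ι] {V : ι → Ω → E}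

lemma integral_norm_sum_sq_le_of_indepFun (hV : ∀ i, MemLp (V i) 2 P)
    (hind : Pairwise fun i j => IndepFun (V i) (V j) P) (h0 : ∑ i, ∫ ω, V i ω ∂P = 0) :
    ∫ ω, ‖∑ i, V i ω‖ ^ 2 ∂P ≤ ∑ i, ∫ ω, ‖V i ω‖ ^ 2 ∂P := by
  classical
  set m : ι → E := fun i => ∫ ω, V i ω ∂P
  have hcov : ∀ i j, ∫ ω, inner ℝ (V i ω) (V j ω) ∂P
      ≤ inner ℝ (m i) (m j) + if i = j then ∫ ω, ‖V i ω‖ ^ 2 ∂P else 0 := fun i j => by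
    rcases eq_or_ne i j with rfl | hij
    · simp only [real_inner_self_eq_norm_sq, if_true]
      exact le_add_of_nonneg_left (sq_nonneg _)
    · rw [if_neg hij, add_zero, integral_inner_of_indepFun (hind hij)
        ((hV i).integrable one_le_two) ((hV j).integrable one_le_two)]
  have hcross : ∑ i, ∑ j, inner ℝ (m i) (m j) = 0 := by
    simp only [← inner_sum, ← sum_inner, h0, inner_zero_left]
  calc ∫ ω, ‖∑ i, V i ω‖ ^ 2 ∂P = ∑ i, ∑ j, ∫ ω, inner ℝ (V i ω) (V j ω) ∂P := by
        simp only [← real_inner_self_eq_norm_sq, sum_inner, inner_sum]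
        rw [Finset.sum_comm, integral_finsetSum _ fun i _ => integrable_finsetSum _ fun j _ =>
          integrable_inner (hV j) (hV i)]
        exact Finset.sum_congr rfl fun i _ =>
          integral_finsetSum _ fun j _ => integrable_inner (hV j) (hV i)
    _ ≤ ∑ i, ∑ j, (inner ℝ (m i) (m j) + if i = j then ∫ ω, ‖V i ω‖ ^ 2 ∂P else 0) :=
        Finset.sum_le_sum fun i _ => Finset.sum_le_sum fun j _ => hcov i j
    _ = ∑ i, ∫ ω, ‖V i ω‖ ^ 2 ∂P := by
        simp only [Finset.sum_add_distrib, hcross, Finset.sum_ite_eq, Finset.mem_univ, if_true,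
          zero_add]

lemma card_sub_one_mul_integral_norm_avg_sq_le [Nonempty ι] (hV : ∀ i, MemLp (V i) 2 P)
    (hind : Pairwise fun i j => IndepFun (V i) (V j) P)
    (h0 : ∫ ω, avg (fun i => V i ω) ∂P = 0) :
    ((Fintype.card ι : ℝ) - 1) * ∫ ω, ‖avg fun i => V i ω‖ ^ 2 ∂P
      ≤ ∫ ω, dispersion (fun i => V i ω) ∂P := by
  have hcard : (0 : ℝ) < Fintype.card ι := by simp [Fintype.card_pos]
  have hsum : ∑ i, ∫ ω, V i ω ∂P = 0 := by
    rw [integral_avg fun i => (hV i).integrable one_le_two, avg, smul_eq_zero] at h0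
    exact h0.resolve_left (by positivity)
  have hsecond : ∫ ω, avg (fun i => ‖V i ω‖ ^ 2) ∂P
      = ∫ ω, dispersion (fun i => V i ω) ∂P + ∫ ω, ‖avg fun i => V i ω‖ ^ 2 ∂P := by
    rw [← integral_add (integrable_dispersion hV) (integrable_norm_sq (memLp_avg hV))]
    exact integral_congr_ae (.of_forall fun ω => by
      simpa only [sub_zero] using avg_norm_sub_sq_eq (fun i => V i ω) 0)
  have hvar : (Fintype.card ι : ℝ) * ∫ ω, ‖avg fun i => V i ω‖ ^ 2 ∂P
      ≤ ∫ ω, avg (fun i => ‖V i ω‖ ^ 2) ∂P := by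
    rw [integral_avg fun i => integrable_norm_sq (hV i)]
    simp only [avg, norm_smul, mul_pow, Real.norm_eq_abs, sq_abs, integral_const_mul, smul_eq_mul]
    calc _ = 1 / (Fintype.card ι : ℝ) * ∫ ω, ‖∑ i, V i ω‖ ^ 2 ∂P := by field_simp
      _ ≤ _ := by gcongr; exact integral_norm_sum_sq_le_of_indepFun hV hind hsum
  linarith

end IndependentAverage

namespace IsGradientOracle

variable {ι ζ E Ω : Type*} [Fintype ι] [Fintype ζ] [Nonempty ι] [Nonempty ζ]
  [NormedAddCommGroup E] [InnerProductSpace ℝ E] [CompleteSpace E] [MeasurableSpace E]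
  [BorelSpace E] [SecondCountableTopology E] {m mΩ : MeasurableSpace Ω} {P : Measure Ω}
  [IsProbabilityMeasure P] {μ L σ δ : ℝ} {g : Ω → ι → ζ → E → E} {xs : Ω → E} {y : E}

lemma card_mul_card_sub_one_mul_integral_norm_avg_sq_le (h : IsGradientOracle m P μ L σ δ g xs)
    (hind : Pairwise fun p q : ι × ζ =>
      IndepFun (fun ω => g ω p.1 p.2 y) (fun ω => g ω q.1 q.2 y) P)
    (hy : ∫ ω, avg (fun i => avg fun j => g ω i j y) ∂P = 0) :
    ((Fintype.card ι : ℝ) * Fintype.card ζ - 1)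
      * ∫ ω, ‖avg fun i => avg fun j => g ω i j y‖ ^ 2 ∂P ≤ σ ^ 2 + δ ^ 2 := by
  have hV : ∀ p : ι × ζ, MemLp (fun ω => g ω p.1 p.2 y) 2 P := fun p =>
    h.memLp_comp measurable_const (memLp_const y) p.1 p.2
  simp only [avg_avg_eq_avg_prod] at hy ⊢
  have hmean := card_sub_one_mul_integral_norm_avg_sq_le hV hind hy
  rw [Fintype.card_prod, Nat.cast_mul] at hmean
  refine hmean.trans ?_
  calc ∫ ω, dispersion (fun p : ι × ζ => g ω p.1 p.2 y) ∂P ≤ ∫ _, (σ ^ 2 + δ ^ 2) ∂P := by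
        refine integral_mono_ae (integrable_dispersion hV) (integrable_const _) ?_
        filter_upwards [h.ae_avg_avg_norm_sub_sq_le] with ω hω
        have hω := hω y
        simp only [avg_avg_eq_avg_prod] at hω
        exact hω
    _ = σ ^ 2 + δ ^ 2 := by simp

lemma integral_norm_avg_sq_le (h : IsGradientOracle m P μ L σ δ g xs) (hμ : 0 < μ)
    (hind : Pairwise fun p q : ι × ζ =>
      IndepFun (fun ω => g ω p.1 p.2 y) (fun ω => g ω q.1 q.2 y) P)
    (hy : ∫ ω, avg (fun i => avg fun j => g ω i j y) ∂P = 0) (x₀ : E) :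
    ∫ ω, ‖avg fun i => avg fun j => g ω i j y‖ ^ 2 ∂P
      ≤ (2 * (σ ^ 2 + δ ^ 2) + 2 * L ^ 2 * (L ^ 2 / μ ^ 2 + 1) * ∫ ω, ‖x₀ - xs ω‖ ^ 2 ∂P)
        / (Fintype.card ι * Fintype.card ζ) := by
  have hindep := h.card_mul_card_sub_one_mul_integral_norm_avg_sq_le hind hy
  have hdet := StronglyMonotoneLip.integral_norm_sq_le hμ
    (fun ω => .avg fun i => .avg fun j => h.stronglyMonotoneLip ω i j)
    (fun x => measurable_avg fun i => measurable_avg fun j => (h.measurable i j x).mono h.le le_rfl)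
    h.memLp_zero h.avg_zero hy x₀
  have hcard : 0 < Fintype.card ι * Fintype.card ζ :=
    Nat.mul_pos Fintype.card_pos Fintype.card_pos
  have hdist : 0 ≤ 2 * L ^ 2 * (L ^ 2 / μ ^ 2 + 1) * ∫ ω, ‖x₀ - xs ω‖ ^ 2 ∂P :=
    mul_nonneg (by positivity) (integral_nonneg fun ω => by positivity)
  have hgrad : 0 ≤ ∫ ω, ‖avg fun i => avg fun j => g ω i j y‖ ^ 2 ∂P :=
    integral_nonneg fun ω => by positivity
  rw [le_div_iff₀ (by exact_mod_cast hcard)]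
  rcases Nat.lt_or_ge 1 (Fintype.card ι * Fintype.card ζ) with hlarge | hone
  · have : (2 : ℝ) ≤ Fintype.card ι * Fintype.card ζ := by exact_mod_cast hlarge
    nlinarith [mul_nonneg (sub_nonneg.2 this) hgrad]
  · have : (Fintype.card ι : ℝ) * Fintype.card ζ = 1 := by
      exact_mod_cast le_antisymm hone hcard
    rw [this, mul_one]
    linarith [sq_nonneg σ, sq_nonneg δ]

end IsGradientOracle

section RandomLoss

variable {Ω E : Type*} {mΩ : MeasurableSpace Ω} {P : Measure Ω} [NormedAddCommGroup E]
  [InnerProductSpace ℝ E] [MeasurableSpace E] [BorelSpace E] [SecondCountableTopology E]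
  {μ L : ℝ} {φ : Ω → E → ℝ} {G : Ω → E → E} {u xs : Ω → E} {y : E}

lemma StronglyConvexSmooth.integrable_comp [IsFiniteMeasure P]
    (h : ∀ ω, StronglyConvexSmooth μ L (φ ω) (G ω)) (hL : 0 ≤ L)
    (hm : ∀ x, Measurable fun ω => φ ω x) (hφ : Integrable (fun ω => φ ω y) P)
    (hG : MemLp (fun ω => G ω y) 2 P) (hum : Measurable u) (hu : MemLp u 2 P) :
    Integrable (fun ω => φ ω (u ω)) P := by
  have huy : MemLp (fun ω => u ω - y) 2 P := hu.sub (memLp_const y)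
  have hmeas : Measurable fun ω => φ ω (u ω) :=
    (measurable_uncurry_of_continuous_of_measurable (u := fun x ω => φ ω x)
      (fun ω => (h ω).continuous) hm).comp (hum.prodMk measurable_id)
  exact ((hφ.abs.add (hG.norm.integrable_mul huy.norm)).add
    ((integrable_norm_sq huy).const_mul L)).mono' hmeas.aestronglyMeasurable
    (.of_forall fun ω => (h ω).abs_le hL (u ω) y)

lemma StronglyConvexSmooth.integral_integral_sub_le [CompleteSpace E] [IsProbabilityMeasure P]
    (h : ∀ ω, StronglyConvexSmooth μ L (φ ω) (G ω)) (hμ : 0 < μ) (hL : 0 ≤ L)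
    (hm : ∀ x, Measurable fun ω => φ ω x) (hφ : ∀ x, Integrable (fun ω => φ ω x) P)
    (hG : ∀ x, MemLp (fun ω => G ω x) 2 P) (hxs : MemLp xs 2 P) (hzero : ∀ ω, G ω (xs ω) = 0)
    (hy : ∫ ω, G ω y ∂P = 0) (hum : Measurable u) (hu : MemLp u 2 P) :
    Integrable (fun ω => ∫ ω', φ ω' (u ω) ∂P - φ ω (u ω)) P ∧
    ∫ ω, (∫ ω', φ ω' (u ω) ∂P - φ ω (u ω)) ∂P
      ≤ (2 * L + 1) * (1 + 1 / μ ^ 2) * (∫ ω, ‖u ω - xs ω‖ ^ 2 ∂P + ∫ ω, ‖G ω y‖ ^ 2 ∂P) := by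
  have hmean := StronglyConvexSmooth.integral h hφ fun x => (hG x).integrable one_le_two
  have hmean_int : Integrable (fun ω => ∫ ω', φ ω' (u ω) ∂P) P :=
    StronglyConvexSmooth.integrable_comp (φ := fun _ x => ∫ ω', φ ω' x ∂P)
      (G := fun _ x => ∫ ω', G ω' x ∂P) (y := y) (fun _ => hmean) hL (fun _ => measurable_const)
      (integrable_const _) (memLp_const _) hum hu
  have hint := hmean_int.sub (StronglyConvexSmooth.integrable_comp h hL hm (hφ y) (hG y) hum hu)
  refine ⟨hint, ?_⟩
  have hdist := integrable_norm_sq (hu.sub hxs)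
  have hgrad := integrable_norm_sq (hG y)
  have hgap : Integrable (fun ω => ∫ ω', φ ω' y ∂P - φ ω y) P := (integrable_const _).sub (hφ y)
  have hgap_zero : ∫ ω, (∫ ω', φ ω' y ∂P - φ ω y) ∂P = 0 := by
    rw [integral_sub (integrable_const _) (hφ y), integral_const, probReal_univ, one_smul, sub_self]
  have hbound := (hdist.add hgrad).const_mul ((2 * L + 1) * (1 + 1 / μ ^ 2))
  refine (integral_mono hint (hgap.add hbound) fun ω =>
    hmean.sub_le_sub_add (h ω) hμ hL (hzero ω) hy (u ω)).trans_eq ?_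
  rw [integral_add' hgap hbound, hgap_zero, zero_add, integral_const_mul, integral_add' hdist hgrad]
  rfl

end RandomLoss

section GeneralizationError

variable {N B Z d : ℕ} {Ξ Ω : Type*} [MeasurableSpace Ξ] {mΩ : MeasurableSpace Ω} {P : Measure Ω}
  {𝓕 : Filtration ℕ mΩ} {D : Fin N → Measure Ξ} {S : Ω → Fin N → Fin Z → Ξ}
  {idx : ℕ → Ω → Fin N → Fin Z} {byz : ℕ → Fin B → Fin N → Ω → Model d} {f : Model d → Ξ → ℝ}
  {μ L lam k₁ ρ σ δ : ℝ} {x₀ : Model d} {xs xS : Ω → Model d}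
  {G : SimpleGraph (Fin N ⊕ Fin B)} {A : (n : Fin N) → AggregationRule G d n}
  {W : Matrix (Fin N) (Fin N) ℝ}

namespace IsByzantineSetup

lemma measurable_sample (h : IsByzantineSetup P 𝓕 D S idx byz) (n : Fin N) (z : Fin Z) :
    Measurable fun ω => S ω n z :=
  (h.data_meas n z).mono (𝓕.le 0) le_rfl

lemma integrable_loss (h : IsByzantineSetup P 𝓕 D S idx byz) {x : Model d}
    (hint : ∀ n, Integrable (f x) (D n)) (n : Fin N) (z : Fin Z) :
    Integrable (fun ω => f x (S ω n z)) P := by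
  have hx := hint n
  rw [← h.data_law n z] at hx
  exact hx.comp_measurable (h.measurable_sample n z)

lemma integrable_localLoss (h : IsByzantineSetup P 𝓕 D S idx byz) {x : Model d}
    (hint : ∀ n, Integrable (f x) (D n)) (n : Fin N) :
    Integrable (fun ω => localLoss f (S ω n) x) P :=
  (integrable_finsetSum _ fun z _ => h.integrable_loss hint n z).const_mul _

lemma integrable_empiricalLoss (h : IsByzantineSetup P 𝓕 D S idx byz) {x : Model d}
    (hint : ∀ n, Integrable (f x) (D n)) : Integrable (fun ω => empiricalLoss f (S ω) x) P :=
  (integrable_finsetSum _ fun n _ => h.integrable_localLoss hint n).const_mul _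

lemma measurable_empiricalLoss (h : IsByzantineSetup P 𝓕 D S idx byz) {x : Model d}
    (hm : Measurable (f x)) : Measurable fun ω => empiricalLoss f (S ω) x :=
  (Finset.measurable_sum _ fun n _ => (Finset.measurable_sum _ fun z _ =>
    hm.comp (h.measurable_sample n z)).const_mul _).const_mul _

lemma populationLoss_eq_integral [NeZero Z] (h : IsByzantineSetup P 𝓕 D S idx byz) {x : Model d}
    (hm : Measurable (f x)) (hint : ∀ n, Integrable (f x) (D n)) :
    populationLoss f D x = ∫ ω, empiricalLoss f (S ω) x ∂P := by
  have hsample : ∀ n z, ∫ ω, f x (S ω n z) ∂P = ∫ ξ, f x ξ ∂(D n) := fun n z => by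
    rw [← h.data_law n z, integral_map (h.measurable_sample n z).aemeasurable
      hm.aestronglyMeasurable]
  have hlocal : ∀ n, ∫ ω, localLoss f (S ω n) x ∂P = ∫ ξ, f x ξ ∂(D n) := fun n => by
    simp only [localLoss_eq_avg]
    rw [integral_avg fun z => h.integrable_loss hint n z]
    simp only [hsample, avg_const]
  simp only [populationLoss, empiricalLoss]
  rw [integral_const_mul, integral_finsetSum _ fun n _ => h.integrable_localLoss hint n]
  simp only [hlocal]

lemma pairwise_indepFun_lossGrad (h : IsByzantineSetup P 𝓕 D S idx byz)
    (hf : StronglyConvexLoss f μ) (hm : ∀ x, Measurable (f x)) (x : Model d) :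
    Pairwise fun p q : Fin N × Fin Z =>
      IndepFun (fun ω => lossGrad f (S ω p.1 p.2) x) (fun ω => lossGrad f (S ω q.1 q.2) x) P :=
  fun _ _ hpq => (h.data_indep.indepFun hpq).comp (hf.measurable_lossGrad hm x)
    (hf.measurable_lossGrad hm x)

lemma exists_measurable_minimizer [NeZero N] [NeZero Z] (h : IsByzantineSetup P 𝓕 D S idx byz)
    (hf : StronglyConvexLoss f μ) (hs : SmoothLoss f L) (hμ : 0 < μ) (hm : ∀ x, Measurable (f x))
    (hxS : ∀ᵐ ω ∂P, ∀ y, empiricalLoss f (S ω) (xS ω) ≤ empiricalLoss f (S ω) y) :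
    ∃ xs : Ω → Model d, Measurable[𝓕 0] xs ∧ (∀ ω, empiricalGrad f (S ω) (xs ω) = 0) ∧
      xs =ᵐ[P] xS := by
  have hG : ∀ ω, StronglyMonotoneLip μ L (empiricalGrad f (S ω)) := fun ω =>
    (hf.stronglyConvexSmooth_empiricalLoss hs hμ.le (S ω)).toStronglyMonotoneLip
  obtain ⟨xs, hxs, hzero⟩ := StronglyMonotoneLip.exists_measurable_zero (mΩ := 𝓕 0) hμ hG
    fun x => measurable_avg fun n => measurable_avg fun z =>
      (hf.measurable_lossGrad hm x).comp (h.data_meas n z)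
  exact ⟨xs, hxs, hzero, hxS.mono fun ω hω =>
    (hG ω).zero_unique hμ (hzero ω) (hf.empiricalGrad_eq_zero hω)⟩

lemma integral_populationLoss_sub_empiricalLoss_le [NeZero N] [NeZero Z] [IsProbabilityMeasure P]
    (h : IsByzantineSetup P 𝓕 D S idx byz)
    (hg : IsGradientOracle (𝓕 0) P μ L σ δ (fun ω n z => lossGrad f (S ω n z)) xs)
    (hf : StronglyConvexLoss f μ) (hs : SmoothLoss f L) (hμ : 0 < μ) (hL : 0 ≤ L)
    (hm : ∀ x, Measurable (f x)) (hint : ∀ x n, Integrable (f x) (D n)) {u : Ω → Model d}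
    (hum : Measurable u) (hu : MemLp u 2 P) (x₀ : Model d) :
    Integrable (fun ω => populationLoss f D (u ω) - empiricalLoss f (S ω) (u ω)) P ∧
    ∫ ω, (populationLoss f D (u ω) - empiricalLoss f (S ω) (u ω)) ∂P
      ≤ (2 * L + 1) * (1 + 1 / μ ^ 2) * (∫ ω, ‖u ω - xs ω‖ ^ 2 ∂P
        + (2 * (σ ^ 2 + δ ^ 2) + 2 * L ^ 2 * (L ^ 2 / μ ^ 2 + 1) * ∫ ω, ‖x₀ - xs ω‖ ^ 2 ∂P)
          / (N * Z)) := by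
  have hconv : ∀ ω, StronglyConvexSmooth μ L (empiricalLoss f (S ω)) (empiricalGrad f (S ω)) :=
    fun ω => hf.stronglyConvexSmooth_empiricalLoss hs hμ.le (S ω)
  have hgrad : ∀ x, MemLp (fun ω => empiricalGrad f (S ω) x) 2 P := fun x =>
    memLp_avg fun n => memLp_avg fun z => hg.memLp_comp measurable_const (memLp_const x) n z
  obtain ⟨y, -, hy⟩ := StronglyMonotoneLip.exists_measurable_zero
    (mΩ := (⊤ : MeasurableSpace Unit)) hμ
    (fun _ => .integral (fun ω => (hconv ω).toStronglyMonotoneLip)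
      fun x => (hgrad x).integrable one_le_two) fun _ => measurable_const
  have hgrad_le := hg.integral_norm_avg_sq_le hμ
    (h.pairwise_indepFun_lossGrad hf hm (y ())) (hy ()) x₀
  obtain ⟨hgap, hgap_le⟩ := StronglyConvexSmooth.integral_integral_sub_le hconv hμ hL
    (fun x => h.measurable_empiricalLoss (hm x)) (fun x => h.integrable_empiricalLoss (hint x))
    hgrad hg.memLp_zero hg.avg_zero (hy ()) hum hu
  simp only [fun x => h.populationLoss_eq_integral (hm x) (hint x)]
  refine ⟨hgap, hgap_le.trans ?_⟩
  gcongr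
  simpa only [empiricalGrad, localGrad, Fintype.card_fin] using hgrad_le

end IsByzantineSetup

/-- The constant of the generalization bound of Byzantine-resilient DSGD with step sizes
`2 / (μ * (k + k₁))`. -/
noncomputable def generalizationConst (μ L lam k₁ : ℝ) : ℝ :=
  (2 * L + 1) * (1 + 1 / μ ^ 2)
    * (k₁ + 2 * rateConst μ L lam + 2 * L ^ 2 * (L ^ 2 / μ ^ 2 + 1) + 2)

lemma generalizationConst_pos (hμ : 0 < μ) (hL : 0 ≤ L) (hlam : 0 < lam) (hk₁ : 0 ≤ k₁) :
    0 < generalizationConst μ L lam k₁ := by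
  have := rateConst_pos (L := L) hμ hlam
  unfold generalizationConst
  positivity

lemma le_generalizationConst_mul {R V t M κ : ℝ} (hμ : 0 < μ) (hL : 0 ≤ L) (hlam : 0 < lam)
    (hk₁ : 0 ≤ k₁) (hR : 0 ≤ R) (hV : 0 ≤ V) (ht : 0 ≤ t) (hM : 0 ≤ M) (hκ : 0 ≤ κ) :
    (2 * L + 1) * (1 + 1 / μ ^ 2)
        * ((k₁ * R + rateConst μ L lam * V) / t + rateConst μ L lam * (2 * κ * V)
          + (2 * V + 2 * L ^ 2 * (L ^ 2 / μ ^ 2 + 1) * R) / M)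
      ≤ generalizationConst μ L lam k₁ * ((R + V) * (1 / t + 1 / M) + κ * V) := by
  rw [generalizationConst, mul_assoc _ (k₁ + _ + _ + _)]
  have hr := (rateConst_pos (L := L) hμ hlam).le
  have hl : 0 ≤ 2 * L ^ 2 * (L ^ 2 / μ ^ 2 + 1) := by positivity
  set r := rateConst μ L lam
  set l := 2 * L ^ 2 * (L ^ 2 / μ ^ 2 + 1)
  set c := k₁ + 2 * r + l + 2
  gcongr
  calc (k₁ * R + r * V) / t + r * (2 * κ * V) + (2 * V + l * R) / M
      = (k₁ * R + r * V) / t + 2 * r * (κ * V) + (2 * V + l * R) / M := by ring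
    _ ≤ (c * R + c * V) / t + c * (κ * V) + (c * V + c * R) / M := by gcongr <;> linarith
    _ = c * ((R + V) * (1 / t + 1 / M) + κ * V) := by ring

lemma generalizationConst_mul_le {a R κ k n : ℝ} (hμ : 0 < μ) (hL : 0 ≤ L) (hlam : 0 < lam)
    (hk₁ : 0 ≤ k₁) (ha : 0 < a) (hR : 0 ≤ R) (hκ : 0 ≤ κ) (hn : 1 ≤ n) (hk : a * (μ * n) ≤ k) :
    generalizationConst μ L lam k₁
        * ((R + (σ ^ 2 + δ ^ 2)) * (1 / (k + k₁) + 1 / n) + κ * (σ ^ 2 + δ ^ 2))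
      ≤ generalizationConst μ L lam k₁ * (1 / a + μ + 1)
        * (R / (μ * n) + σ ^ 2 * (1 + Real.log n) / (μ * n) + δ ^ 2 / (μ * n)
          + κ * (σ ^ 2 + δ ^ 2)) := by
  have hC := generalizationConst_pos hμ hL hlam hk₁
  have hk_nonneg : 0 ≤ k := le_trans (by positivity) hk
  have hlog : 0 ≤ Real.log n := Real.log_nonneg hn
  set T := (R + σ ^ 2 * (1 + Real.log n) + δ ^ 2) / (μ * n) with hT
  have hT_nonneg : 0 ≤ T := by positivity
  have hsum : R / (μ * n) + σ ^ 2 * (1 + Real.log n) / (μ * n) + δ ^ 2 / (μ * n) = T := by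
    rw [hT, add_div, add_div]
  have htime : 1 / (k + k₁) + 1 / n ≤ (1 / a + μ) * (1 / (μ * n)) :=
    calc 1 / (k + k₁) + 1 / n ≤ 1 / (a * (μ * n)) + 1 / n := by gcongr; linarith
      _ = (1 / a + μ) * (1 / (μ * n)) := by field_simp
  rw [hsum, mul_assoc (generalizationConst _ _ _ _)]
  gcongr
  calc (R + (σ ^ 2 + δ ^ 2)) * (1 / (k + k₁) + 1 / n) + κ * (σ ^ 2 + δ ^ 2)
      ≤ (R + (σ ^ 2 * (1 + Real.log n) + δ ^ 2)) * ((1 / a + μ) * (1 / (μ * n)))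
        + κ * (σ ^ 2 + δ ^ 2) := by
        gcongr
        exact le_mul_of_one_le_right (sq_nonneg σ) (by linarith)
    _ = (1 / a + μ) * T + κ * (σ ^ 2 + δ ^ 2) := by rw [hT]; ring
    _ ≤ (1 / a + μ + 1) * (T + κ * (σ ^ 2 + δ ^ 2)) := by
        have hX : 0 ≤ (1 / a + μ) * (κ * (σ ^ 2 + δ ^ 2)) := by positivity
        linarith

theorem theorem6_general [NeZero N] [NeZero Z] [IsProbabilityMeasure P] (hμ : 0 < μ) (hL : 0 ≤ L)
    (hlam : 0 < lam) (hk₁ : shiftThreshold μ L lam ≤ k₁)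
    (hA : ∀ n, Measurable fun p : Model d × (G.neighborSet (Sum.inl n) → Model d) => A n p.1 p.2)
    (hW : IsVirtualMixing G A W ρ) (hgap : mixingGap W = lam) (hρ : ρ < lam / (8 * √(N : ℝ)))
    (h : IsByzantineSetup P 𝓕 D S idx byz) (hm : ∀ x, Measurable (f x))
    (hint : ∀ x n, Integrable (f x) (D n)) (hf : StronglyConvexLoss f μ) (hs : SmoothLoss f L)
    (hσ : ∀ᵐ ω ∂P, BoundedNoise f (S ω) σ) (hδ : ∀ᵐ ω ∂P, BoundedHeterogeneity f (S ω) δ)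
    {x : ℕ → Ω → Fin N → Model d}
    (hx : x = dsgd f G A (fun k => 2 / (μ * (k + k₁))) x₀ S idx byz)
    (hxS : ∀ᵐ ω ∂P, ∀ y, empiricalLoss f (S ω) (xS ω) ≤ empiricalLoss f (S ω) y)
    (hxS2 : MemLp (fun ω => meanModel (x 0 ω) - xS ω) 2 P) (k : ℕ) :
    Integrable (fun ω => populationLoss f D (meanModel (x k ω))
      - empiricalLoss f (S ω) (meanModel (x k ω))) P ∧
    ∫ ω, (populationLoss f D (meanModel (x k ω))
        - empiricalLoss f (S ω) (meanModel (x k ω))) ∂P ≤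
      generalizationConst μ L lam k₁
        * ((∫ ω, ‖meanModel (x 0 ω) - xS ω‖ ^ 2 ∂P + (σ ^ 2 + δ ^ 2))
            * (1 / (k + k₁) + 1 / (N * Z))
          + (4 * ρ ^ 2 * N + chiSq W) * (σ ^ 2 + δ ^ 2)) := by
  have hk₁_nonneg : 0 ≤ k₁ := zero_le_two.trans (two_le_of_shiftThreshold_le hlam hk₁)
  have hκ : 0 ≤ 4 * ρ ^ 2 * N + chiSq W := add_nonneg (by positivity) (chiSq_nonneg W)
  have hx0 : ∀ ω, avg (x 0 ω) = x₀ := fun _ => hx ▸ avg_const x₀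
  obtain ⟨xs, hxs, hzero, hxs_eq⟩ := h.exists_measurable_minimizer hf hs hμ hm hxS
  simp only [meanModel_eq_avg, hx0] at hxS2 ⊢
  have hxs2 : MemLp xs 2 P := by
    refine (memLp_congr_ae hxs_eq).2 ?_
    simpa only [Pi.sub_def, sub_sub_cancel] using (memLp_const x₀).sub hxS2
  have hdist : ∫ ω, ‖x₀ - xS ω‖ ^ 2 ∂P = ∫ ω, ‖x₀ - xs ω‖ ^ 2 ∂P :=
    integral_congr_ae (hxs_eq.mono fun ω hω => by simp only [hω])
  have hg := h.isGradientOracle hf hs hm hσ hδ hxs hzero hxs2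
  have hrun := hx ▸ h.isConsensusSGD (x₀ := x₀) (α := fun k => 2 / (μ * (k + k₁))) hg hA hW hlam
    hgap hρ
  have hrate := hrun.integral_norm_avg_sub_sq_le hg hμ hlam hk₁ (hgap ▸ mixingGap_le_one W)
    (by positivity) k
  obtain ⟨hgen_int, hgen⟩ := h.integral_populationLoss_sub_empiricalLoss_le hg hf hs hμ hL hm hint
    (measurable_avg fun n => (hrun.measurable k n).mono (𝓕.le k) le_rfl)
    (memLp_avg (hrun.memLp k)) x₀
  simp only [hx0] at hrate
  refine ⟨hgen_int, hgen.trans (le_trans ?_ (le_generalizationConst_mul hμ hL hlam hk₁_nonneg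
    (integral_nonneg fun ω => by positivity) (by positivity) (by positivity) (by positivity) hκ))⟩
  rw [hdist]
  gcongr

end GeneralizationError

theorem theorem6 (μ L lam : ℝ) (hμ : 0 < μ) (hL : 0 < L) (hlam : 0 < lam) :
    ∃ K : ℝ, 0 < K ∧ ∀ k₁ : ℝ, K ≤ k₁ →
    ∀ a b : ℝ, 0 < a → a ≤ b →
    ∃ C : ℝ, 0 < C ∧
    ∀ (N B Z d : ℕ), 0 < N → 0 < Z →
    -- the network and the robust aggregation rules
    ∀ (G : SimpleGraph (Fin N ⊕ Fin B)), G.Connected → (G.comap Sum.inl).Connected →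
    ∀ (A : (n : Fin N) → AggregationRule G d n),
    (∀ n, Measurable (fun p : Model d × (G.neighborSet (Sum.inl n) → Model d) => A n p.1 p.2)) →
    ∀ (W : Matrix (Fin N) (Fin N) ℝ) (ρ : ℝ), IsVirtualMixing G A W ρ →
    mixingGap W = lam → ρ < lam / (8 * √(N : ℝ)) →
    -- the loss, the data distributions, the random dataset, draws and Byzantine messages
    ∀ (Ξ : Type*) [MeasurableSpace Ξ] (f : Model d → Ξ → ℝ) (D : Fin N → Measure Ξ)
      (Ω : Type*) (mΩ : MeasurableSpace Ω) (P : Measure Ω) (𝓕 : Filtration ℕ mΩ)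
      (S : Ω → Fin N → Fin Z → Ξ) (idx : ℕ → Ω → Fin N → Fin Z)
      (byz : ℕ → Fin B → Fin N → Ω → Model d),
    IsProbabilityMeasure P → IsByzantineSetup P 𝓕 D S idx byz →
    (∀ x, Measurable (f x)) → (∀ x n, Integrable (f x) (D n)) →
    StronglyConvexLoss f μ → SmoothLoss f L →
    ∀ (σ δ : ℝ), 0 ≤ σ → 0 ≤ δ →
    (∀ᵐ ω ∂P, BoundedNoise f (S ω) σ) → (∀ᵐ ω ∂P, BoundedHeterogeneity f (S ω) δ) →
    -- the initial model, the iterates and the minimizer of the empirical loss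
    ∀ (x₀ : Model d) (x : ℕ → Ω → Fin N → Model d),
    x = dsgd f G A (fun k => 2 / (μ * (k + k₁))) x₀ S idx byz →
    ∀ (xS : Ω → Model d), (∀ᵐ ω ∂P, ∀ y, empiricalLoss f (S ω) (xS ω) ≤ empiricalLoss f (S ω) y) →
    MemLp (fun ω => meanModel (x 0 ω) - xS ω) 2 P →
    ∀ k : ℕ, a * (μ * N * Z) ≤ k → k ≤ b * (μ * N * Z) →
      Integrable (fun ω => populationLoss f D (meanModel (x k ω))
        - empiricalLoss f (S ω) (meanModel (x k ω))) P ∧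
      ∫ ω, (populationLoss f D (meanModel (x k ω))
          - empiricalLoss f (S ω) (meanModel (x k ω))) ∂P ≤
        C * ((∫ ω, ‖meanModel (x 0 ω) - xS ω‖ ^ 2 ∂P) / (μ * N * Z)
          + σ ^ 2 * (1 + Real.log (N * Z)) / (μ * N * Z)
          + δ ^ 2 / (μ * N * Z)
          + (4 * ρ ^ 2 * N + chiSq W) * (σ ^ 2 + δ ^ 2)) := by
  refine ⟨shiftThreshold μ L lam, zero_lt_two.trans_le (two_le_of_shiftThreshold_le hlam le_rfl),
    fun k₁ hk₁ a b ha _ => ?_⟩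
  have hk₁_nonneg : 0 ≤ k₁ := zero_le_two.trans (two_le_of_shiftThreshold_le hlam hk₁)
  have hC := generalizationConst_pos hμ hL.le hlam hk₁_nonneg
  refine ⟨generalizationConst μ L lam k₁ * (1 / a + μ + 1), by positivity, ?_⟩
  intro N B Z d hN hZ G _ _ A hA W ρ hW hgap hρ Ξ _ f D Ω mΩ P 𝓕 S idx byz _ h hm hint hf hs σ δ _ _
    hσ hδ x₀ x hx xS hxS hxS2 k hk _
  have : NeZero N := ⟨hN.ne'⟩
  have : NeZero Z := ⟨hZ.ne'⟩
  have hNZ : (1 : ℝ) ≤ N * Z := by exact_mod_cast Nat.mul_pos hN hZ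
  have hκ : 0 ≤ 4 * ρ ^ 2 * N + chiSq W := add_nonneg (by positivity) (chiSq_nonneg W)
  obtain ⟨hgen_int, hgen⟩ := theorem6_general hμ hL.le hlam hk₁ hA hW hgap hρ h hm hint hf hs hσ hδ
    hx hxS hxS2 k
  simp only [mul_assoc μ] at hk ⊢
  exact ⟨hgen_int, hgen.trans (generalizationConst_mul_le hμ hL.le hlam hk₁_nonneg ha
    (integral_nonneg fun ω => by positivity) hκ hNZ hk)⟩
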